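/- For $n\ge1$, $s,t\in[-n\pi,n\pi]$ and $1\le i\le n$ put $$v_i=\Big(\cos\tfrac{it}{n},-\tfrac in\sin\tfrac{it}{n},\cos\tfrac{is}{n},-\tfrac in\sin\tfrac{is}{n}\Big),\qquad v_i'=\Big(\sin\tfrac{it}{n},\tfrac in\cos\tfrac{it}{n},\sin\tfrac{is}{n},\tfrac in\cos\tfrac{is}{n}\Big).$$ Let $y_{i1},y_{i2}$ $(1\le i\le n)$ be iid copies of a real random variable $\xi$ with mean $0$ and variance $1$, let $S_n(s,t,Y)=\sum_{i=1}^n (y_{i1}v_i+y_{i2}v_i')$, and for $x\in\mathbb R^4$ let $$\phi_i(x)=\mathbb E e^{\sqrt{-1}\,y_{i1}\langle v_i,x\rangle}\;\mathbb E e^{\sqrt{-1}\,y_{i2}\langle v_i',x\rangle},\qquad \phi_{\mathbb R^4}(x)=\prod_{i=1}^n\phi_i(x).$$ For $\tau>0$ say that $s,t\in[-n\pi,n\pi]$ satisfy the Diophantine condition with parameter $\tau$ if there are no integers $k,l$, not both zero, with $|k|,|l|\le n^{\tau}$ and $\big\|k\frac{s}{\pi n}+l\frac{t}{\pi n}\big\|_{\mathbb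 R/\mathbb Z}\le n^{-1+8\tau}$, where $\|\cdot\|_{\mathbb R/\mathbb Z}$ is the distance to the nearest integer. **Theorem.** Let $C_*>0$ and an integer $\ell\ge0$ be given. There is $\tau_0>0$ such that for every $0<\tau<\tau_0$ there is $\sigma_0>0$ (depending on $C_*,\ell,\tau$) such that for every $0<\tau_*<\sigma_0$ the following holds for all sufficiently large $n$. For all $s,t\in[-n\pi,n\pi]$ satisfying the Diophantine condition with parameter $\tau$ and all $x\in\mathbb R^4$ with $n^{5\tau-1/2}\le\|x\|_2\le n^{C_*}$, the function $\phi_{\mathbb R^4}$ is the characteristic function of $S_n(s,t,Y)$ at $x$, $$|\phi_{\mathbb R^4}(x)|\le\exp(-n^{\tau_*}),$$ and, for every $I\subset\{1,\dots,n\}$ with at most $\ell$ elements, $$\Big|\prod_{i\notin I}\phi_i(x)\Big|\le\exp(-n^{\tau_*}).$$ Here "sufficiently large" depends only on $C_*,\ell,\tau,\tau_*$ and the law of $\xi$; moreover, for every $\varepsilon_0>0$ and $M$, it can be chosen to depend only on $C_*,\ell,\tau,\tau_*,\varepsilon_0,M$, uniformly over all such laws with $\mathbb E|\xi|^{2+\varepsilon_0}\le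 M$. -/

import Mathlib

open MeasureTheory ProbabilityTheory

universe u

/-- The vector `v_i(s,t) ∈ ℝ⁴`. -/
noncomputable def vecV (n i : ℕ) (s t : ℝ) : EuclideanSpace ℝ (Fin 4) :=
  !₂[Real.cos (i * t / n), -((i : ℝ) / n) * Real.sin (i * t / n),
    Real.cos (i * s / n), -((i : ℝ) / n) * Real.sin (i * s / n)]

/-- The vector `v_i'(s,t) ∈ ℝ⁴`. -/
noncomputable def vecV' (n i : ℕ) (s t : ℝ) : EuclideanSpace ℝ (Fin 4) :=
  !₂[Real.sin (i * t / n), ((i : ℝ) / n) * Real.cos (i * t / n),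
    Real.sin (i * s / n), ((i : ℝ) / n) * Real.cos (i * s / n)]

/-- The Diophantine condition on `s, t ∈ [-nπ, nπ]`: no nontrivial combination
`k s/(πn) + l t/(πn)` with integers `|k|, |l| ≤ n^τ` is within `n^(-1+8τ)` of an integer.
The norm on `UnitAddCircle = ℝ/ℤ` is the distance to the nearest integer. -/
def DiophantineCondition (τ : ℝ) (n : ℕ) (s t : ℝ) : Prop :=
  s ∈ Set.Icc (-(n * Real.pi)) (n * Real.pi) ∧ t ∈ Set.Icc (-(n * Real.pi)) (n * Real.pi) ∧
    ¬ ∃ k l : ℤ, |(k : ℝ)| ≤ (n : ℝ) ^ τ ∧ |(l : ℝ)| ≤ (n : ℝ) ^ τ ∧ (k ≠ 0 ∨ l ≠ 0) ∧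
      ‖((k * (s / (Real.pi * n)) + l * (t / (Real.pi * n)) : ℝ) : UnitAddCircle)‖
        ≤ (n : ℝ) ^ (-1 + 8 * τ)

/-- A probability law on `ℝ` with mean zero and variance one. -/
structure IsStandardizedLaw (μ : Measure ℝ) : Prop where
  isProbabilityMeasure : IsProbabilityMeasure μ
  memLp : MemLp id 2 μ
  mean_eq_zero : ∫ a, a ∂μ = 0
  variance_eq_one : Var[id; μ] = 1

section Walk

variable {Ω : Type*} [MeasurableSpace Ω]

/-- The coefficients `y_{i1}, y_{i2}`, `1 ≤ i ≤ n`, are independent with common law `μ`.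
Here and below the index `k : Fin n` stands for `i = k + 1`, and the second index in `Fin 2`
is shifted by one in the same way. -/
structure IsIIDArray (P : Measure Ω) (μ : Measure ℝ) {n : ℕ} (y : Fin n → Fin 2 → Ω → ℝ) :
    Prop where
  hasLaw : ∀ k j, HasLaw (y k j) μ P
  indep : iIndepFun (fun p : Fin n × Fin 2 => y p.1 p.2) P

/-- The random walk `S_n(s,t,Y) = ∑ i, (y_{i1} v_i + y_{i2} v_i')` in `ℝ⁴`. -/
noncomputable def randomWalk {n : ℕ} (s t : ℝ) (y : Fin n → Fin 2 → Ω → ℝ) (ω : Ω) :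
    EuclideanSpace ℝ (Fin 4) :=
  ∑ k : Fin n, (y k 0 ω • vecV n (k + 1) s t + y k 1 ω • vecV' n (k + 1) s t)

/-- The factor `φ_i(x) = E e(y_{i1} ⟨v_i, x⟩) · E e(y_{i2} ⟨v_i', x⟩)`, with `e(u) = exp(√-1 u)`. -/
noncomputable def phiFactor (P : Measure Ω) {n : ℕ} (s t : ℝ) (y : Fin n → Fin 2 → Ω → ℝ)
    (k : Fin n) (x : EuclideanSpace ℝ (Fin 4)) : ℂ :=
  (∫ ω, Complex.exp (Complex.I * ((y k 0 ω * inner ℝ (vecV n (k + 1) s t) x : ℝ) : ℂ)) ∂P) *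
    ∫ ω, Complex.exp (Complex.I * ((y k 1 ω * inner ℝ (vecV' n (k + 1) s t) x : ℝ) : ℂ)) ∂P

/-- The function `φ_{ℝ⁴}(x) = ∏ i, φ_i(x)`. -/
noncomputable def phiR4 (P : Measure Ω) {n : ℕ} (s t : ℝ) (y : Fin n → Fin 2 → Ω → ℝ)
    (x : EuclideanSpace ℝ (Fin 4)) : ℂ :=
  ∏ k : Fin n, phiFactor P s t y k x

end Walk

/-- The decay statement at a given `n` for the coefficient law `μ`: for all `s, t` satisfying the
Diophantine condition, every array of iid coefficients with law `μ` and every `x` with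
`n^(5τ - 1/2) ≤ ‖x‖ ≤ n^C`, the function `φ_{ℝ⁴}` is the characteristic function of the walk,
it is at most `exp(-n^σ)` in modulus at `x`, and so is every product of the `φ_i(x)` with at
most `m` indices omitted. -/
def FourierDecay (C τ σ : ℝ) (m n : ℕ) (μ : Measure ℝ) : Prop :=
  ∀ s t : ℝ, DiophantineCondition τ n s t →
  ∀ (Ω : Type u) [MeasurableSpace Ω] (P : Measure Ω) [IsProbabilityMeasure P]
    (y : Fin n → Fin 2 → Ω → ℝ), IsIIDArray P μ y →
  ∀ x : EuclideanSpace ℝ (Fin 4), (n : ℝ) ^ (5 * τ - 1 / 2) ≤ ‖x‖ → ‖x‖ ≤ (n : ℝ) ^ C →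
    charFun (P.map (randomWalk s t y)) x = phiR4 P s t y x ∧
    ‖phiR4 P s t y x‖ ≤ Real.exp (-(n : ℝ) ^ σ) ∧
    ∀ I : Finset (Fin n), I.card ≤ m →
      ‖∏ k ∈ Iᶜ, phiFactor P s t y k x‖ ≤ Real.exp (-(n : ℝ) ^ σ)

/-!
Why the Fourier decay holds. Conditioning on the values `w` of the difference `ξ - ξ'` of two
independent copies of the coefficient turns a lower bound for
`∑ i, ‖w ⟨v_i, x⟩ / 2π‖² + ‖w ⟨v_i', x⟩ / 2π‖²` (distances to the nearest integer) into an upper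
bound for `∏ i, |φ_i(x)|`, see `norm_charFun_le_exp` and `IsIIDArray.norm_prod_phiFactor_le`. Since
`ξ` has variance one and controlled tails, `1 ≤ |w| ≤ 2 R` has probability bounded below
(`IsStandardizedLaw.le_measureReal_sub_mem`), so everything rests on a deterministic lower bound for
such sums, `exists_forall_lt_sum_distInt`.

For the latter, put `a = t / n`, `b = s / n` and combine the two inner products into
`⟨v_i, y⟩ + √-1 ⟨v_i', y⟩ = (y₀ + √-1 y₁ i / n) e^{√-1 i a} + (y₂ + √-1 y₃ i / n) e^{√-1 i b}`.
If the sum were small, this would be close to a Gaussian integer `p_i` for all but few `i`, hence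
for all `i` in a long block. By simultaneous approximation there is a step `d ≤ n ^ τ` such that
`d a` and `d b` are close to `2π ℤ`; along a progression of step `d` in the block both exponentials
vary slowly, so a difference of bounded order `r` makes them, and with them the `r`-th difference of
`p`, smaller than `1`. A Gaussian integer smaller than `1` vanishes, so `p` is killed by
`(E - 1) ^ r`, `E` being the shift (`twistedDiff_one_iterate_eq_zero`), and then also by
`(E ^ h - 1) ^ r` for any `h`. The Diophantine condition makes `z₁ = e^{√-1 d a}`,
`z₂ = e^{√-1 d b}` and `1` so well separated that for suitable `h`, `k`, much shorter than the
progression, the operator `(E ^ h - 1) ^ r (E ^ k - z₂ ^ k) ^ 2` removes `p` and the second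
exponential while keeping the coefficients of the first one (`coeff_le_of_sum_norm_sub_le`). What
remains is small in `ℓ¹`, which forces `y₀`, `y₁` and, by symmetry, `y₂`, `y₃` to be smaller than
`‖y‖ ≥ n ^ (4 τ - 1 / 2)` allows.
-/

/-! ### Twisted differences of exponential sequences -/

/-- The twisted difference operator `f ↦ (j ↦ f (j + h) - c * f j)` on complex sequences. For
`c = z ^ h` it annihilates the geometric sequence `z ^ j`, for `c = 1` the constants. -/
noncomputable def twistedDiff (h : ℕ) (c : ℂ) (f : ℕ → ℂ) (j : ℕ) : ℂ := f (j + h) - c * f j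

/-- The sequence `(A + B j) z ^ j`, an exponential with a coefficient affine in `j`. -/
noncomputable def linExp (A B z : ℂ) (j : ℕ) : ℂ := (A + B * j) * z ^ j

lemma twistedDiff_add (h : ℕ) (c : ℂ) (f g : ℕ → ℂ) :
    twistedDiff h c (f + g) = twistedDiff h c f + twistedDiff h c g := by
  funext j; simp only [twistedDiff, Pi.add_apply]; ring

lemma twistedDiff_iterate_add (h : ℕ) (c : ℂ) (r : ℕ) (f g : ℕ → ℂ) :
    (twistedDiff h c)^[r] (f + g) = (twistedDiff h c)^[r] f + (twistedDiff h c)^[r] g := by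
  induction r generalizing f g with
  | zero => rfl
  | succ r ih => simp only [Function.iterate_succ_apply, twistedDiff_add, ih]

lemma twistedDiff_sub (h : ℕ) (c : ℂ) (f g : ℕ → ℂ) :
    twistedDiff h c (f - g) = twistedDiff h c f - twistedDiff h c g := by
  funext j; simp only [twistedDiff, Pi.sub_apply]; ring

lemma twistedDiff_iterate_sub (h : ℕ) (c : ℂ) (r : ℕ) (f g : ℕ → ℂ) :
    (twistedDiff h c)^[r] (f - g) = (twistedDiff h c)^[r] f - (twistedDiff h c)^[r] g := by
  induction r generalizing f g with
  | zero => rfl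
  | succ r ih => simp only [Function.iterate_succ_apply, twistedDiff_sub, ih]

/-- Over a window, `(E ^ h - 1) ^ r` is divisible by `(E - 1) ^ r`, where `E` is the shift. -/
lemma twistedDiff_iterate_eq_zero_of_one {h : ℕ} (r : ℕ) (f : ℕ → ℂ) (M : ℕ)
    (hf : ∀ j, j + r < M → (twistedDiff 1 1)^[r] f j = 0) :
    ∀ j, j + r * h < M → (twistedDiff h 1)^[r] f j = 0 := by
  induction r generalizing f M with
  | zero => intro j hj; exact hf j (by simpa using hj)
  | succ r ih =>
    intro j hj
    rw [Function.iterate_succ_apply]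
    refine ih (twistedDiff h 1 f) (M - h) (fun i hi ↦ ?_) j (by rw [Nat.succ_mul] at hj; omega)
    have key : ∀ h' ≤ h, (twistedDiff 1 1)^[r] (twistedDiff h' 1 f) i = 0 := by
      intro h' hh'
      induction h' with
      | zero =>
        have : twistedDiff 0 1 f = 0 := by funext k; simp [twistedDiff]
        have h2 := twistedDiff_iterate_sub 1 1 r f f
        rw [sub_self, sub_self] at h2
        rw [this, h2]; rfl
      | succ h' ih' =>
        have h1 : twistedDiff (h' + 1) 1 f =
            twistedDiff h' 1 f + fun k ↦ (twistedDiff 1 1 f) (k + h') := by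
          funext k
          simp only [twistedDiff, Pi.add_apply, one_mul]
          rw [show k + h' + 1 = k + (h' + 1) by ring]
          ring
        have h2 : ∀ (s : ℕ) (g : ℕ → ℂ) (a : ℕ),
            (twistedDiff 1 1)^[s] (fun k ↦ g (k + a)) =
              fun k ↦ (twistedDiff 1 1)^[s] g (k + a) := by
          intro s
          induction s with
          | zero => intros; rfl
          | succ s ihs =>
            intro g a
            rw [Function.iterate_succ_apply, Function.iterate_succ_apply, ← ihs]
            congr 1
            funext k
            simp only [twistedDiff]
            rw [show k + 1 + a = k + a + 1 by ring]
        rw [h1, twistedDiff_iterate_add, Pi.add_apply, ih' (by omega), h2, zero_add,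
          ← Function.iterate_succ_apply]
        exact hf _ (by omega)
    exact key h le_rfl

lemma sum_norm_twistedDiff_le (h : ℕ) {c : ℂ} (hc : ‖c‖ ≤ 1) (f : ℕ → ℂ) {N N' : ℕ}
    (hN : N + h ≤ N') :
    ∑ j ∈ Finset.range N, ‖twistedDiff h c f j‖ ≤ 2 * ∑ j ∈ Finset.range N', ‖f j‖ := by
  have h1 : ∑ j ∈ Finset.range N, ‖f (j + h)‖ ≤ ∑ j ∈ Finset.range N', ‖f j‖ := by
    calc ∑ j ∈ Finset.range N, ‖f (j + h)‖
        = ∑ j ∈ (Finset.range N).map (addRightEmbedding h), ‖f j‖ := by simp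
      _ ≤ _ := by
          refine Finset.sum_le_sum_of_subset_of_nonneg ?_ (fun _ _ _ ↦ norm_nonneg _)
          intro j
          simp only [Finset.mem_map, Finset.mem_range, addRightEmbedding_apply]
          rintro ⟨a, ha, rfl⟩; omega
  have h2 : ∑ j ∈ Finset.range N, ‖f j‖ ≤ ∑ j ∈ Finset.range N', ‖f j‖ :=
    Finset.sum_le_sum_of_subset_of_nonneg (Finset.range_mono (by omega))
      (fun _ _ _ ↦ norm_nonneg _)
  calc ∑ j ∈ Finset.range N, ‖twistedDiff h c f j‖
      ≤ ∑ j ∈ Finset.range N, (‖f (j + h)‖ + ‖f j‖) := by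
        refine Finset.sum_le_sum fun j _ ↦ (norm_sub_le _ _).trans ?_
        rw [norm_mul]
        have := mul_le_of_le_one_left (norm_nonneg (f j)) hc
        linarith
    _ ≤ _ := by rw [Finset.sum_add_distrib]; linarith

lemma sum_norm_twistedDiff_iterate_le (h : ℕ) {c : ℂ} (hc : ‖c‖ ≤ 1) (r : ℕ) (f : ℕ → ℂ)
    {N N' : ℕ} (hN : N + r * h ≤ N') :
    ∑ j ∈ Finset.range N, ‖(twistedDiff h c)^[r] f j‖
      ≤ 2 ^ r * ∑ j ∈ Finset.range N', ‖f j‖ := by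
  induction r generalizing f N' with
  | zero =>
    simpa using Finset.sum_le_sum_of_subset_of_nonneg (Finset.range_mono (by omega))
      (fun j _ _ ↦ norm_nonneg (f j))
  | succ r ih =>
    rw [Nat.succ_mul] at hN
    rw [Function.iterate_succ_apply]
    refine (ih (N' := N' - h) _ (by omega)).trans ?_
    have := sum_norm_twistedDiff_le h hc f (N := N' - h) (N' := N') (by omega)
    rw [pow_succ, mul_assoc]
    gcongr

lemma norm_twistedDiff_iterate_le (r : ℕ) (f : ℕ → ℂ) {ε : ℝ} {N' : ℕ}
    (hf : ∀ j < N', ‖f j‖ ≤ ε) (j : ℕ) (hj : j + r < N') :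
    ‖(twistedDiff 1 1)^[r] f j‖ ≤ 2 ^ r * ε := by
  induction r generalizing f N' ε with
  | zero => simpa using hf j hj
  | succ r ih =>
    rw [Function.iterate_succ_apply, pow_succ, mul_assoc]
    refine ih (N' := N' - 1) _ (fun i hi ↦ ?_) (by omega)
    refine (norm_sub_le _ _).trans ?_
    rw [one_mul]
    linarith [hf (i + 1) (by omega), hf i (by omega)]

lemma twistedDiff_linExp (h : ℕ) (c A B z : ℂ) :
    twistedDiff h c (linExp A B z) =
      linExp ((z ^ h - c) * A + h * z ^ h * B) ((z ^ h - c) * B) z := by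
  funext j; simp only [twistedDiff, linExp, pow_add]; push_cast; ring

lemma twistedDiff_twistedDiff_linExp_self (h : ℕ) (A B z : ℂ) :
    twistedDiff h (z ^ h) (twistedDiff h (z ^ h) (linExp A B z)) = 0 := by
  rw [twistedDiff_linExp, twistedDiff_linExp]
  funext j; simp [linExp]

/-- If `z ^ h` is far from `c`, then the twisted difference does not lose the coefficients
of `(A + B j) z ^ j`, measured at the scale `N` of the step `h`. -/
lemma exists_twistedDiff_linExp_eq {h N : ℕ} (hh : h ≤ 2 * N) {c z : ℂ} (hz : ‖z‖ = 1)
    (hzc : 1 / 2 ≤ ‖z ^ h - c‖) (A B : ℂ) :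
    ∃ A' B', twistedDiff h c (linExp A B z) = linExp A' B' z ∧
      ‖A‖ + N * ‖B‖ ≤ 10 * (‖A'‖ + N * ‖B'‖) := by
  refine ⟨_, _, twistedDiff_linExp h c A B z, ?_⟩
  set μ := z ^ h - c
  have hB : ‖B‖ ≤ 2 * ‖μ * B‖ := by
    rw [norm_mul]; nlinarith [norm_nonneg B]
  have hA : ‖μ‖ * ‖A‖ ≤ ‖μ * A + h * z ^ h * B‖ + h * ‖B‖ := by
    have : μ * A = (μ * A + h * z ^ h * B) - h * z ^ h * B := by ring
    rw [← norm_mul]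
    calc ‖μ * A‖ ≤ ‖μ * A + h * z ^ h * B‖ + ‖h * z ^ h * B‖ := by
          conv_lhs => rw [this]
          exact norm_sub_le _ _
      _ = _ := by simp [hz]
  have hA' : ‖A‖ ≤ 2 * (‖μ‖ * ‖A‖) := by nlinarith [norm_nonneg A]
  have hh' : (h : ℝ) * ‖B‖ ≤ 2 * N * ‖B‖ := by
    gcongr; exact_mod_cast hh
  have hNB : (N : ℝ) * ‖B‖ ≤ N * (2 * ‖μ * B‖) := by gcongr
  nlinarith [norm_nonneg (μ * A + h * z ^ h * B)]

lemma exists_twistedDiff_iterate_linExp_eq {h N : ℕ} (hh : h ≤ 2 * N) {c z : ℂ} (hz : ‖z‖ = 1)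
    (hzc : 1 / 2 ≤ ‖z ^ h - c‖) (r : ℕ) (A B : ℂ) :
    ∃ A' B', (twistedDiff h c)^[r] (linExp A B z) = linExp A' B' z ∧
      ‖A‖ + N * ‖B‖ ≤ 10 ^ r * (‖A'‖ + N * ‖B'‖) := by
  induction r generalizing A B with
  | zero => exact ⟨A, B, rfl, by simp⟩
  | succ r ih =>
    obtain ⟨A₁, B₁, h₁, h₂⟩ := exists_twistedDiff_linExp_eq hh hz hzc A B
    obtain ⟨A₂, B₂, h₃, h₄⟩ := ih A₁ B₁
    refine ⟨A₂, B₂, by rw [Function.iterate_succ_apply, h₁, h₃], h₂.trans ?_⟩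
    rw [pow_succ]; linarith

/-- If `z` is close to `1`, each unit difference shrinks `(A + B j) z ^ j`. -/
lemma exists_twistedDiff_one_iterate_linExp_eq {δ : ℝ} (hδ : 0 < δ) {z : ℂ} (hz : ‖z‖ = 1)
    (hzδ : ‖z - 1‖ ≤ δ) (r : ℕ) (A B : ℂ) :
    ∃ A' B', (twistedDiff 1 1)^[r] (linExp A B z) = linExp A' B' z ∧
      ‖A'‖ + ‖B'‖ / δ ≤ (2 * δ) ^ r * (‖A‖ + ‖B‖ / δ) := by
  induction r generalizing A B with
  | zero => exact ⟨A, B, rfl, by simp⟩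
  | succ r ih =>
    obtain ⟨A₂, B₂, h₃, h₄⟩ := ih ((z ^ 1 - 1) * A + (1 : ℕ) * z ^ 1 * B) ((z ^ 1 - 1) * B)
    refine ⟨A₂, B₂, by rw [Function.iterate_succ_apply, twistedDiff_linExp, h₃], h₄.trans ?_⟩
    rw [pow_succ (2 * δ), mul_assoc ((2 * δ) ^ r)]
    refine mul_le_mul_of_nonneg_left ?_ (by positivity)
    rw [pow_one, Nat.cast_one, one_mul, norm_mul (z - 1) B]
    have h1 : ‖(z - 1) * A + z * B‖ ≤ δ * ‖A‖ + ‖B‖ := by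
      refine (norm_add_le _ _).trans ?_
      rw [norm_mul, norm_mul, hz, one_mul]
      gcongr
    have h2 : ‖z - 1‖ * ‖B‖ / δ ≤ ‖B‖ := by
      rw [div_le_iff₀ hδ, mul_comm]; gcongr
    have h3 : 2 * δ * (‖A‖ + ‖B‖ / δ) = 2 * δ * ‖A‖ + 2 * ‖B‖ := by field_simp
    rw [h3]
    nlinarith [norm_nonneg A, norm_nonneg B]

lemma norm_linExp_le {z : ℂ} (hz : ‖z‖ = 1) (A B : ℂ) (j : ℕ) :
    ‖linExp A B z j‖ ≤ ‖A‖ + ‖B‖ * j := by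
  rw [linExp, norm_mul, norm_pow, hz, one_pow, mul_one]
  simpa using norm_add_le A (B * j)

/-- The coefficients of `(A + B j) z ^ j` are controlled by its `ℓ¹` norm on a window. -/
lemma coeff_le_of_sum_norm_linExp_le {z : ℂ} (hz : ‖z‖ = 1) (A B : ℂ) (N : ℕ) {W : ℝ}
    (hW : ∑ j ∈ Finset.range (2 * N), ‖linExp A B z j‖ ≤ W) :
    N * (‖A‖ + N * ‖B‖) ≤ 3 * W := by
  have hn : ∀ j : ℕ, ‖linExp A B z j‖ = ‖A + B * j‖ := fun j ↦ by
    rw [linExp, norm_mul, norm_pow, hz, one_pow, mul_one]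
  simp only [hn] at hW
  have hsplit : ∑ j ∈ Finset.range N, ‖A + B * j‖
      + ∑ j ∈ Finset.range N, ‖A + B * ((N + j : ℕ) : ℂ)‖ ≤ W := by
    rw [two_mul, Finset.sum_range_add] at hW; exact hW
  have hpos : 0 ≤ ∑ j ∈ Finset.range N, ‖A + B * ((N + j : ℕ) : ℂ)‖ := by positivity
  have hB : (N : ℝ) * (N * ‖B‖) ≤ W := by
    calc (N : ℝ) * (N * ‖B‖) = ∑ j ∈ Finset.range N, (N * ‖B‖) := by simp
      _ ≤ ∑ j ∈ Finset.range N, (‖A + B * j‖ + ‖A + B * ((N + j : ℕ) : ℂ)‖) := by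
          refine Finset.sum_le_sum fun j _ ↦ ?_
          have : (N : ℂ) * B = (A + B * ((N + j : ℕ) : ℂ)) - (A + B * j) := by push_cast; ring
          calc (N : ℝ) * ‖B‖ = ‖(N : ℂ) * B‖ := by simp
            _ ≤ ‖A + B * ((N + j : ℕ) : ℂ)‖ + ‖A + B * j‖ := by rw [this]; exact norm_sub_le _ _
            _ = _ := add_comm _ _
      _ ≤ W := by rw [Finset.sum_add_distrib]; exact hsplit
  have hA : (N : ℝ) * ‖A‖ ≤ W + N * (N * ‖B‖) := by
    calc (N : ℝ) * ‖A‖ = ∑ j ∈ Finset.range N, ‖A‖ := by simp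
      _ ≤ ∑ j ∈ Finset.range N, (‖A + B * j‖ + N * ‖B‖) := by
          refine Finset.sum_le_sum fun j hj ↦ ?_
          calc ‖A‖ = ‖(A + B * j) - B * j‖ := by congr 1; ring
            _ ≤ ‖A + B * j‖ + ‖B * j‖ := norm_sub_le _ _
            _ ≤ _ := by
              rw [norm_mul, mul_comm ‖B‖]
              gcongr
              simpa using (Finset.mem_range.1 hj).le
      _ ≤ W + N * (N * ‖B‖) := by
          rw [Finset.sum_add_distrib]; simp only [Finset.sum_const, Finset.card_range, nsmul_eq_mul]
          linarith
  linarith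

/-! ### Sequences close to Gaussian integers -/

lemma twistedDiff_one_iterate_mem {G : Subring ℂ} (r : ℕ) (f : ℕ → ℂ) (hf : ∀ j, f j ∈ G)
    (j : ℕ) : (twistedDiff 1 1)^[r] f j ∈ G := by
  induction r generalizing f with
  | zero => exact hf j
  | succ r ih =>
    rw [Function.iterate_succ_apply]
    exact ih _ fun i ↦ G.sub_mem (hf _) (G.mul_mem G.one_mem (hf _))

lemma eq_zero_of_mem_gaussianInt_of_norm_lt_one {w : ℂ} (hw : w ∈ GaussianInt.toComplex.range)
    (h : ‖w‖ < 1) : w = 0 := by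
  obtain ⟨g, rfl⟩ := hw
  have hre := (Complex.abs_re_le_norm (GaussianInt.toComplex g)).trans_lt h
  have him := (Complex.abs_im_le_norm (GaussianInt.toComplex g)).trans_lt h
  rw [← GaussianInt.intCast_re, ← Int.cast_abs] at hre
  rw [← GaussianInt.intCast_im, ← Int.cast_abs] at him
  have h1 : g.re = 0 := Int.abs_lt_one_iff.1 (by exact_mod_cast hre)
  have h2 : g.im = 0 := Int.abs_lt_one_iff.1 (by exact_mod_cast him)
  have : g = 0 := by ext <;> simp [h1, h2]
  rw [this, map_zero]

lemma exists_twistedDiff_iterate_linExp (h : ℕ) (c z : ℂ) (r : ℕ) (A B : ℂ) :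
    ∃ A' B', (twistedDiff h c)^[r] (linExp A B z) = linExp A' B' z := by
  induction r generalizing A B with
  | zero => exact ⟨_, _, rfl⟩
  | succ r ih =>
    rw [Function.iterate_succ_apply, twistedDiff_linExp]
    exact ih _ _

/-- Over a window on which the `r`-th difference of `p` vanishes, subtracting `p` from the
exponential sequence `(A₁ + B₁ j) z₁ ^ j + (A₂ + B₂ j) z₂ ^ j` cannot make it small in `ℓ¹`
unless `A₁`, `B₁` are small, provided that `1, z₁, z₂` are separated: `(E ^ h - 1) ^ r` removes
`p`, and `(E ^ k - z₂ ^ k) ^ 2` removes the second exponential (`E` is the shift). -/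
lemma coeff_le_of_sum_norm_sub_le {z₁ z₂ : ℂ} (hz₁ : ‖z₁‖ = 1) (hz₂ : ‖z₂‖ = 1)
    {A₁ B₁ A₂ B₂ : ℂ} {N r h k : ℕ} (hN : r * h + 2 * k ≤ 2 * N) (hr : 0 < r)
    (h1 : 1 / 2 ≤ ‖z₁ ^ h - 1‖) (h2 : 1 / 2 ≤ ‖z₁ ^ k - z₂ ^ k‖)
    {p : ℕ → ℂ} (hp : ∀ j, j + r < 4 * N → (twistedDiff 1 1)^[r] p j = 0) {W : ℝ}
    (hW : ∑ j ∈ Finset.range (4 * N), ‖(linExp A₁ B₁ z₁ + linExp A₂ B₂ z₂ - p) j‖ ≤ W) :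
    N * (‖A₁‖ + N * ‖B₁‖) ≤ 3 * 20 ^ (r + 2) * W := by
  have hhN : h ≤ 2 * N := by nlinarith
  obtain ⟨A', B', e1, l1⟩ := exists_twistedDiff_iterate_linExp_eq hhN hz₁ h1 r A₁ B₁
  obtain ⟨A'', B'', e2, l2⟩ := exists_twistedDiff_iterate_linExp_eq (h := k) (N := N)
    (by omega) hz₁ h2 2 A' B'
  obtain ⟨A₃, B₃, e3⟩ := exists_twistedDiff_iterate_linExp h 1 z₂ r A₂ B₂
  have hG : ∀ j < 2 * N + 2 * k, (linExp A' B' z₁ + linExp A₃ B₃ z₂) j =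
      (twistedDiff h 1)^[r] (linExp A₁ B₁ z₁ + linExp A₂ B₂ z₂ - p) j := by
    intro j hj
    rw [twistedDiff_iterate_sub, twistedDiff_iterate_add, e1, e3, Pi.sub_apply,
      twistedDiff_iterate_eq_zero_of_one r p (4 * N) hp j (by omega), sub_zero]
  have hGsum : ∑ j ∈ Finset.range (2 * N + 2 * k),
      ‖(linExp A' B' z₁ + linExp A₃ B₃ z₂) j‖ ≤ 2 ^ r * W := by
    rw [Finset.sum_congr rfl fun j hj ↦ by rw [hG j (Finset.mem_range.1 hj)]]
    refine (sum_norm_twistedDiff_iterate_le h (by simp) r _ (N' := 4 * N) (by omega)).trans ?_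
    gcongr
  have hT : (twistedDiff k (z₂ ^ k))^[2] (linExp A' B' z₁ + linExp A₃ B₃ z₂) =
      linExp A'' B'' z₁ := by
    rw [twistedDiff_iterate_add, e2]
    simp only [Function.iterate_succ_apply, Function.iterate_zero_apply,
      twistedDiff_twistedDiff_linExp_self, add_zero]
  have hfin : ∑ j ∈ Finset.range (2 * N), ‖linExp A'' B'' z₁ j‖ ≤ 2 ^ (r + 2) * W := by
    rw [← hT]
    refine (sum_norm_twistedDiff_iterate_le k (by simp [hz₂]) 2 _
      (N' := 2 * N + 2 * k) le_rfl).trans ?_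
    rw [pow_add, mul_comm (2 ^ r), mul_assoc]
    gcongr
  have h3 := coeff_le_of_sum_norm_linExp_le hz₁ A'' B'' N hfin
  calc (N : ℝ) * (‖A₁‖ + N * ‖B₁‖)
      ≤ N * (10 ^ r * (10 ^ 2 * (‖A''‖ + N * ‖B''‖))) := by
        gcongr; exact l1.trans (by gcongr)
    _ = 10 ^ (r + 2) * (N * (‖A''‖ + N * ‖B''‖)) := by ring
    _ ≤ 10 ^ (r + 2) * (3 * (2 ^ (r + 2) * W)) := by gcongr
    _ = 3 * 20 ^ (r + 2) * W := by
        rw [show (20 : ℝ) = 10 * 2 by norm_num, mul_pow]; ring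

/-- A Gaussian integer sequence close to a slowly varying exponential sequence has vanishing
`r`-th difference, since that difference is a Gaussian integer of modulus less than `1`. -/
lemma twistedDiff_one_iterate_eq_zero {z₁ z₂ : ℂ} (hz₁ : ‖z₁‖ = 1) (hz₂ : ‖z₂‖ = 1)
    {A₁ B₁ A₂ B₂ : ℂ} {N r : ℕ} {δ P : ℝ} (hδ : 0 < δ) (hδ₁ : ‖z₁ - 1‖ ≤ δ) (hδ₂ : ‖z₂ - 1‖ ≤ δ)
    (hP : ‖A₁‖ + ‖B₁‖ / δ + (‖A₂‖ + ‖B₂‖ / δ) ≤ P)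
    (hPr : (2 * δ) ^ r * ((1 + δ * N) * P) ≤ 1 / 2)
    {p : ℕ → ℂ} (hp : ∀ j, p j ∈ GaussianInt.toComplex.range)
    (hF : ∀ j < N, ‖(linExp A₁ B₁ z₁ + linExp A₂ B₂ z₂ - p) j‖ ≤ 1 / (4 * 2 ^ r))
    (j : ℕ) (hj : j + r < N) : (twistedDiff 1 1)^[r] p j = 0 := by
  obtain ⟨A₃, B₃, e₁, l₁⟩ := exists_twistedDiff_one_iterate_linExp_eq hδ hz₁ hδ₁ r A₁ B₁
  obtain ⟨A₄, B₄, e₂, l₂⟩ := exists_twistedDiff_one_iterate_linExp_eq hδ hz₂ hδ₂ r A₂ B₂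
  refine eq_zero_of_mem_gaussianInt_of_norm_lt_one (twistedDiff_one_iterate_mem r p hp j) ?_
  have hlin : ∀ {A B z : ℂ}, ‖z‖ = 1 → ‖linExp A B z j‖ ≤ (1 + δ * N) * (‖A‖ + ‖B‖ / δ) := by
    intro A B z hz
    have hjN : (j : ℝ) ≤ N := by exact_mod_cast (by omega : j ≤ N)
    calc ‖linExp A B z j‖ ≤ ‖A‖ + ‖B‖ * j := norm_linExp_le hz A B j
      _ ≤ ‖A‖ + ‖B‖ * N := by gcongr
      _ ≤ ‖A‖ + ‖B‖ * N + (‖B‖ / δ + δ * N * ‖A‖) := le_add_of_nonneg_right (by positivity)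
      _ = _ := by field_simp; ring
  have hdiff := norm_twistedDiff_iterate_le r _ hF j hj
  rw [twistedDiff_iterate_sub, twistedDiff_iterate_add, e₁, e₂] at hdiff
  have hε : (2 : ℝ) ^ r * (1 / (4 * 2 ^ r)) = 1 / 4 := by field_simp
  rw [hε] at hdiff
  have hδN : 0 ≤ 1 + δ * N := by positivity
  have hsum : ‖(linExp A₃ B₃ z₁ + linExp A₄ B₄ z₂) j‖ ≤ 1 / 2 := by
    calc ‖(linExp A₃ B₃ z₁ + linExp A₄ B₄ z₂) j‖
        ≤ (1 + δ * N) * (‖A₃‖ + ‖B₃‖ / δ) + (1 + δ * N) * (‖A₄‖ + ‖B₄‖ / δ) :=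
          (norm_add_le _ _).trans (add_le_add (hlin hz₁) (hlin hz₂))
      _ ≤ (1 + δ * N) * ((2 * δ) ^ r * P) := by
          rw [← mul_add]
          gcongr
          refine (add_le_add l₁ l₂).trans ?_
          rw [← mul_add]
          gcongr
      _ ≤ 1 / 2 := by linarith
  calc ‖(twistedDiff 1 1)^[r] p j‖
      = ‖(linExp A₃ B₃ z₁ + linExp A₄ B₄ z₂) j
          - (linExp A₃ B₃ z₁ + linExp A₄ B₄ z₂ - (twistedDiff 1 1)^[r] p) j‖ := by
        congr 1; simp
    _ ≤ 1 / 2 + 1 / 4 := (norm_sub_le _ _).trans (add_le_add hsum hdiff)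
    _ < 1 := by norm_num

/-- A step of order `1 / |θ|` separates `exp (i θ)` from `1`. -/
lemma exists_half_le_norm_exp_pow_sub_one {θ : ℝ} (h0 : θ ≠ 0) (h1 : |θ| ≤ 1) :
    ∃ h : ℕ, h * |θ| ≤ 2 ∧ 1 / 2 ≤ ‖Complex.exp (Complex.I * θ) ^ h - 1‖ := by
  have hpos := abs_pos.2 h0
  set h := ⌈1 / |θ|⌉₊
  have hlo : 1 ≤ h * |θ| := by
    have := Nat.le_ceil (1 / |θ|)
    rwa [div_le_iff₀ hpos] at this
  have hhi : h * |θ| ≤ 2 := by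
    have := (Nat.ceil_lt_add_one (a := 1 / |θ|) (by positivity)).le
    calc (h : ℝ) * |θ| ≤ (1 / |θ| + 1) * |θ| := by gcongr
      _ = 1 + |θ| := by field_simp
      _ ≤ 2 := by linarith
  refine ⟨h, hhi, ?_⟩
  have e : Complex.exp (Complex.I * θ) ^ h = Complex.exp (Complex.I * ((h * θ : ℝ) : ℂ)) := by
    rw [← Complex.exp_nat_mul]; congr 1; push_cast; ring
  rw [e, Complex.norm_exp_I_mul_ofReal_sub_one, Real.norm_eq_abs, abs_mul, abs_two]
  have hs : |Real.sin (h * θ / 2)| = Real.sin (h * |θ| / 2) := by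
    have hx : |(h : ℝ) * θ / 2| = h * |θ| / 2 := by
      rw [abs_div, abs_mul, Nat.abs_cast, abs_two]
    rw [← hx, Real.abs_sin_eq_sin_abs_of_abs_le_pi]
    rw [hx]; linarith [Real.pi_gt_three]
  rw [hs]
  have := Real.mul_le_sin (x := h * |θ| / 2) (by positivity) (by linarith [Real.pi_gt_three])
  have hpi : 1 / 4 ≤ 2 / Real.pi * (h * |θ| / 2) := by
    rw [div_mul_eq_mul_div, le_div_iff₀ Real.pi_pos]
    linarith [Real.pi_lt_four]
  linarith

/-! ### Simultaneous approximation and progressions without bad indices -/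

/-- Dirichlet's theorem for two reals, by the pigeonhole principle. -/
lemma exists_simultaneous_approx (α β : ℝ) {Q : ℕ} (hQ : 0 < Q) :
    ∃ d : ℕ, 0 < d ∧ d ≤ Q ^ 2 ∧
      (∃ p : ℤ, |d * α - p| ≤ 1 / Q) ∧ ∃ p : ℤ, |d * β - p| ≤ 1 / Q := by
  have hQ' : (0 : ℝ) < Q := by exact_mod_cast hQ
  let b : ℝ → ℕ := fun x ↦ ⌊Int.fract x * Q⌋₊
  have hb : ∀ x, b x < Q := fun x ↦ by
    rw [Nat.floor_lt (mul_nonneg (Int.fract_nonneg x) hQ'.le)]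
    nlinarith [Int.fract_lt_one x]
  have hclose : ∀ x x', b x = b x' → |(x' - x) - ((⌊x'⌋ - ⌊x⌋ : ℤ) : ℝ)| ≤ 1 / Q := by
    intro x x' h
    have l1 := Nat.floor_le (mul_nonneg (Int.fract_nonneg x) hQ'.le)
    have l2 := Nat.lt_floor_add_one (Int.fract x * Q)
    have l3 := Nat.floor_le (mul_nonneg (Int.fract_nonneg x') hQ'.le)
    have l4 := Nat.lt_floor_add_one (Int.fract x' * Q)
    change (⌊Int.fract x * Q⌋₊ : ℕ) = ⌊Int.fract x' * Q⌋₊ at h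
    rw [← h] at l3 l4
    have e : (x' - x) - ((⌊x'⌋ - ⌊x⌋ : ℤ) : ℝ) = Int.fract x' - Int.fract x := by
      rw [← Int.self_sub_floor, ← Int.self_sub_floor]; push_cast; ring
    rw [e, abs_le]
    constructor
    · rw [neg_le, le_div_iff₀ hQ']; linarith
    · rw [le_div_iff₀ hQ']; linarith
  obtain ⟨j, hj, j', hj', hne, heq⟩ := Finset.exists_ne_map_eq_of_card_lt_of_maps_to
    (s := Finset.range (Q ^ 2 + 1)) (t := Finset.range Q ×ˢ Finset.range Q)
    (f := fun j : ℕ ↦ (b (j * α), b (j * β)))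
    (by rw [Finset.card_product, Finset.card_range, Finset.card_range]; nlinarith)
    (fun j _ ↦ by simp [hb])
  simp only [Prod.mk.injEq] at heq
  rw [Finset.mem_range] at hj hj'
  wlog hlt : j < j' generalizing j j'
  · exact this j' hj' j hj hne.symm ⟨heq.1.symm, heq.2.symm⟩ (by omega)
  refine ⟨j' - j, by omega, by omega, ⟨⌊j' * α⌋ - ⌊j * α⌋, ?_⟩, ⟨⌊j' * β⌋ - ⌊j * β⌋, ?_⟩⟩
  · rw [Nat.cast_sub hlt.le, sub_mul]; exact hclose _ _ heq.1
  · rw [Nat.cast_sub hlt.le, sub_mul]; exact hclose _ _ heq.2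

lemma exists_block_disjoint (S : Finset ℕ) {q : ℕ} (ℓ : ℕ) (hS : S.card < q) :
    ∃ k < q, ∀ j < ℓ, k * ℓ + j ∉ S := by
  obtain ⟨k, hk, hk'⟩ := Finset.exists_mem_notMem_of_card_lt_card
    (s := S.image (· / ℓ)) (t := Finset.range q)
    (by rw [Finset.card_range]; exact Finset.card_image_le.trans_lt hS)
  refine ⟨k, Finset.mem_range.1 hk, fun j hj hmem ↦ hk' ?_⟩
  refine Finset.mem_image.2 ⟨_, hmem, ?_⟩
  show (k * ℓ + j) / ℓ = k
  rw [mul_comm, Nat.mul_add_div (by omega), Nat.div_eq_of_lt hj, add_zero]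

/-- If a nonnegative function has a small sum off the set `I`, some long progression avoids both
`I` and the large values of the function. -/
lemma exists_progression_le {n : ℕ} (I : Finset (Fin n)) {u : ℕ → ℝ} (hu : ∀ k, 0 ≤ u k)
    {H ε : ℝ} (hε : 0 < ε) (hsum : ∑ k ∈ Iᶜ, u k ≤ H) {q ℓ d L : ℕ}
    (hq : I.card + H / ε < q) (hfit : q * ℓ ≤ n) (hd : 0 < d) (hL : d * L ≤ ℓ) :
    ∃ i₀, (∀ j < L, i₀ + d * j < n) ∧ (∀ j < L, u (i₀ + d * j) ≤ ε) ∧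
      ∑ j ∈ Finset.range L, u (i₀ + d * j) ≤ H := by
  classical
  set B := Iᶜ.filter fun k : Fin n ↦ ε < u k with hB
  have hBcard : (B.card : ℝ) ≤ H / ε := by
    rw [le_div_iff₀ hε, ← nsmul_eq_mul]
    calc B.card • ε ≤ ∑ k ∈ B, u k :=
          Finset.card_nsmul_le_sum _ _ _ fun k hk ↦ (Finset.mem_filter.1 hk).2.le
      _ ≤ ∑ k ∈ Iᶜ, u k :=
          Finset.sum_le_sum_of_subset_of_nonneg (Finset.filter_subset _ _) fun k _ _ ↦ hu k
      _ ≤ H := hsum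
  have hcard : ((I ∪ B).map Fin.valEmbedding).card < q := by
    rw [Finset.card_map]
    have h1 : ((I ∪ B).card : ℝ) ≤ I.card + B.card := by exact_mod_cast Finset.card_union_le I B
    exact_mod_cast (show ((I ∪ B).card : ℝ) < q by linarith)
  obtain ⟨k, hk, hfree⟩ := exists_block_disjoint _ ℓ hcard
  have hkl : (k + 1) * ℓ ≤ n := (Nat.mul_le_mul_right ℓ hk).trans hfit
  have hlt : ∀ j < L, d * j < ℓ := fun j hj ↦ (Nat.mul_lt_mul_of_pos_left hj hd).trans_le hL
  have hn : ∀ j < L, k * ℓ + d * j < n := fun j hj ↦ by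
    have := hlt j hj; rw [add_mul, one_mul] at hkl; omega
  have hmem : ∀ j (hj : j < L), (⟨k * ℓ + d * j, hn j hj⟩ : Fin n) ∉ I ∪ B := by
    intro j hj hIB
    exact hfree _ (hlt j hj) (Finset.mem_map.2 ⟨_, hIB, rfl⟩)
  refine ⟨k * ℓ, hn, fun j hj ↦ ?_, ?_⟩
  · by_contra! hlt'
    have := hmem j hj
    simp only [Finset.mem_union, not_or, hB, Finset.mem_filter, Finset.mem_compl, not_and] at this
    exact this.2 this.1 hlt'
  · refine le_trans ?_ hsum
    rw [← Finset.sum_coe_sort (Finset.range L)]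
    have hinj : Function.Injective (fun j : Finset.range L ↦
        (⟨k * ℓ + d * j, hn j (Finset.mem_range.1 j.2)⟩ : Fin n)) := by
      intro j j' h
      simp only [Fin.mk.injEq, add_right_inj] at h
      exact Subtype.ext (Nat.eq_of_mul_eq_mul_left hd h)
    have hmap := Finset.sum_map Finset.univ ⟨_, hinj⟩ (fun k : Fin n ↦ u k)
    refine hmap.symm.trans_le ?_
    refine Finset.sum_le_sum_of_subset_of_nonneg ?_ fun k _ _ ↦ hu k
    intro x hx
    obtain ⟨j, -, rfl⟩ := Finset.mem_map.1 hx
    have := hmem j (Finset.mem_range.1 j.2)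
    simp only [Finset.mem_union, not_or] at this
    simpa using this.1

/-! ### The inner products with `v_i` and `v_i'` -/

/-- The distance of a real number to the nearest integer. -/
noncomputable def distInt (x : ℝ) : ℝ := |x - round x|

/-- Pairing the two inner products into one complex number leaves only the frequencies `t / n`
and `s / n`, each once, instead of `± t / n` and `± s / n`. -/
lemma inner_vecV_add_inner_vecV' (n i : ℕ) (s t : ℝ) (y : EuclideanSpace ℝ (Fin 4)) :
    ((inner ℝ (vecV n i s t) y : ℝ) : ℂ) + Complex.I * (inner ℝ (vecV' n i s t) y : ℝ) =
      (y 0 + Complex.I * (y 1 * (i / n))) * Complex.exp (Complex.I * (i * (t / n) : ℝ))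
      + (y 2 + Complex.I * (y 3 * (i / n))) * Complex.exp (Complex.I * (i * (s / n) : ℝ)) := by
  have h : ∀ x : ℝ, Complex.exp (Complex.I * x) = Real.cos x + Complex.I * Real.sin x := by
    intro x; rw [mul_comm, Complex.exp_mul_I]; push_cast; ring
  rw [h, h, show (i : ℝ) * (t / n) = i * t / n by ring,
    show (i : ℝ) * (s / n) = i * s / n by ring]
  simp only [vecV, vecV', PiLp.inner_apply, Fin.sum_univ_four, RCLike.inner_apply, conj_trivial]
  apply Complex.ext <;> simp [-Complex.ofReal_cos, -Complex.ofReal_sin] <;> ring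

/-- The Diophantine condition for `k (s / n) + l (t / n)` modulo `2π`. In the definition the angles
are divided by `π`, so integers `2 p` there correspond to `2π p` here. -/
lemma DiophantineCondition.le_abs {τ s t : ℝ} {n : ℕ} (hD : DiophantineCondition τ n s t)
    (hn : 0 < n) {k l : ℤ} (hk : |(k : ℝ)| ≤ (n : ℝ) ^ τ) (hl : |(l : ℝ)| ≤ (n : ℝ) ^ τ)
    (hkl : k ≠ 0 ∨ l ≠ 0) (p : ℤ) :
    (n : ℝ) ^ (-1 + 8 * τ) ≤ |k * (s / n) + l * (t / n) - 2 * Real.pi * p| := by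
  have h := hD.2.2
  push Not at h
  have h1 := h k l hk hl hkl
  rw [UnitAddCircle.norm_eq] at h1
  have h2 := round_le (k * (s / (Real.pi * n)) + l * (t / (Real.pi * n))) (2 * p)
  have hn' : (n : ℝ) ≠ 0 := by exact_mod_cast hn.ne'
  have hpi := Real.pi_pos
  have h3 : k * (s / n) + l * (t / n) - 2 * Real.pi * p =
      Real.pi * (k * (s / (Real.pi * n)) + l * (t / (Real.pi * n)) - ((2 * p : ℤ) : ℝ)) := by
    push_cast; field_simp
  rw [h3, abs_mul, abs_of_pos hpi]
  nlinarith [Real.pi_gt_three, abs_nonneg (k * (s / (Real.pi * n)) + l * (t / (Real.pi * n))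
    - ((2 * p : ℤ) : ℝ))]

/-! ### Lower bounds for the distance to the integers -/

/-- Along a progression of step `d`, the frequency `a` may be replaced by `d a` modulo `2π`. -/
lemma linExp_exp_eq (x₀ x₁ a : ℝ) (n i₀ d j : ℕ) (p : ℤ) :
    linExp ((x₀ + Complex.I * (x₁ * (((i₀ + 1 : ℕ) : ℂ) / n)))
        * Complex.exp (Complex.I * ((i₀ + 1 : ℕ) * a : ℝ)))
      (Complex.I * (x₁ * ((d : ℂ) / n)) * Complex.exp (Complex.I * ((i₀ + 1 : ℕ) * a : ℝ)))
      (Complex.exp (Complex.I * (d * a - 2 * Real.pi * p : ℝ))) j =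
    (x₀ + Complex.I * (x₁ * (((i₀ + d * j + 1 : ℕ) : ℂ) / n)))
      * Complex.exp (Complex.I * ((i₀ + d * j + 1 : ℕ) * a : ℝ)) := by
  have h1 : Complex.exp (Complex.I * (d * a - 2 * Real.pi * p : ℝ)) =
      Complex.exp (Complex.I * (d * a : ℝ)) := by
    rw [Complex.exp_eq_exp_iff_exists_int]
    exact ⟨-p, by push_cast; ring⟩
  have h2 : Complex.exp (Complex.I * ((i₀ + d * j + 1 : ℕ) * a : ℝ)) =
      Complex.exp (Complex.I * ((i₀ + 1 : ℕ) * a : ℝ))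
        * Complex.exp (Complex.I * (d * a : ℝ)) ^ j := by
    rw [← Complex.exp_nat_mul, ← Complex.exp_add]
    congr 1; push_cast; ring
  rw [linExp, h1, h2]
  push_cast
  ring

lemma norm_le_sum_abs_coord (y : EuclideanSpace ℝ (Fin 4)) :
    ‖y‖ ≤ |y 0| + |y 1| + (|y 2| + |y 3|) := by
  rw [EuclideanSpace.norm_eq, Real.sqrt_le_left (by positivity), Fin.sum_univ_four]
  simp only [Real.norm_eq_abs]
  have h (i j : Fin 4) : 0 ≤ |y i| * |y j| := by positivity
  nlinarith [h 0 1, h 0 2, h 0 3, h 1 2, h 1 3, h 2 3]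

/-- From the coefficients of `(A + B j) z ^ j` along a progression back to the coordinates. -/
lemma coord_le_of_coeff_le {x₀ x₁ : ℝ} {e : ℂ} (he : ‖e‖ = 1) {n i d N : ℕ} (hi : i ≤ n)
    (hd : 0 < d) (hN : 0 < N) (hNn : N ≤ n) {V : ℝ}
    (h : N * (‖((x₀ : ℂ) + Complex.I * (x₁ * ((i : ℂ) / n))) * e‖
      + N * ‖Complex.I * (x₁ * ((d : ℂ) / n)) * e‖) ≤ V) :
    (|x₀| + |x₁|) * N ^ 2 ≤ 3 * n * V := by
  have hN' : (0 : ℝ) < N := by exact_mod_cast hN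
  have hn' : (0 : ℝ) < n := by exact_mod_cast hN.trans_le hNn
  have hNn' : (N : ℝ) ≤ n := by exact_mod_cast hNn
  have hd' : (1 : ℝ) ≤ d := by exact_mod_cast hd
  have hin : (i : ℝ) / n ≤ 1 := by rw [div_le_one hn']; exact_mod_cast hi
  set A := ‖(x₀ : ℂ) + Complex.I * (x₁ * ((i : ℂ) / n))‖ with hA
  have hB : ‖Complex.I * (x₁ * ((d : ℂ) / n)) * e‖ = |x₁| * (d / n) := by simp [he]
  rw [norm_mul, he, mul_one, hB, ← hA] at h
  have hx₀ : |x₀| ≤ A + |x₁| := by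
    have h1 : ‖Complex.I * (x₁ * ((i : ℂ) / n))‖ ≤ |x₁| := by
      simpa using mul_le_of_le_one_right (abs_nonneg x₁) hin
    calc |x₀| = ‖((x₀ : ℂ) + Complex.I * (x₁ * ((i : ℂ) / n)))
          - Complex.I * (x₁ * ((i : ℂ) / n))‖ := by simp
      _ ≤ A + |x₁| := (norm_sub_le _ _).trans (by gcongr)
  have hA0 : 0 ≤ A := norm_nonneg _
  have h2 : |x₁| * (N : ℝ) ^ 2 ≤ n * (N * (N * (|x₁| * (d / n)))) := by
    have : n * (N * (N * (|x₁| * ((d : ℝ) / n)))) = |x₁| * (N : ℝ) ^ 2 * d := by field_simp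
    rw [this]
    exact le_mul_of_one_le_right (by positivity) hd'
  have h3 : A * (N : ℝ) ^ 2 ≤ n * (N * A) := by
    calc A * (N : ℝ) ^ 2 = N * (N * A) := by ring
      _ ≤ n * (N * A) := by gcongr
  have h4 : n * (N * A) ≤ n * V := by
    gcongr; exact le_trans (by gcongr; exact le_add_of_nonneg_right (by positivity)) h
  have h5 : n * (N * (N * (|x₁| * ((d : ℝ) / n)))) ≤ n * V := by
    gcongr; exact le_trans (by gcongr; exact le_add_of_nonneg_left hA0) h
  nlinarith [sq_nonneg (N : ℝ)]

lemma norm_coeff_add_div_le {x₀ x₁ Y : ℝ} {e : ℂ} (he : ‖e‖ = 1) {n i d Q : ℕ} (hi : i ≤ n)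
    (hd : d ≤ n) (hn : 0 < n) (hQ : 1 ≤ Q) (h₀ : |x₀| ≤ Y) (h₁ : |x₁| ≤ Y) :
    ‖((x₀ : ℂ) + Complex.I * (x₁ * ((i : ℂ) / n))) * e‖
      + ‖Complex.I * (x₁ * ((d : ℂ) / n)) * e‖ / (2 * Real.pi / Q) ≤ 5 / 2 * Y * Q := by
  have hn' : (0 : ℝ) < n := by exact_mod_cast hn
  have hQ' : (1 : ℝ) ≤ Q := by exact_mod_cast hQ
  have hY : 0 ≤ Y := (abs_nonneg _).trans h₀
  have frac : ∀ j ≤ n, ‖Complex.I * (x₁ * ((j : ℂ) / n))‖ ≤ Y := by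
    intro j hj
    have : (j : ℝ) / n ≤ 1 := by rw [div_le_one hn']; exact_mod_cast hj
    have h2 : ‖Complex.I * (x₁ * ((j : ℂ) / n))‖ = |x₁| * ((j : ℝ) / n) := by simp
    rw [h2]
    exact (mul_le_of_le_one_right (abs_nonneg x₁) this).trans h₁
  rw [norm_mul, norm_mul _ e, he, mul_one, mul_one, div_div_eq_mul_div]
  have hA : ‖(x₀ : ℂ) + Complex.I * (x₁ * ((i : ℂ) / n))‖ ≤ 2 * Y := by
    refine (norm_add_le _ _).trans ?_
    rw [Complex.norm_real, Real.norm_eq_abs]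
    linarith [frac i hi]
  have hB : ‖Complex.I * (x₁ * ((d : ℂ) / n))‖ * Q / (2 * Real.pi) ≤ Y * Q / 2 := by
    have hpi : (2 : ℝ) ≤ 2 * Real.pi := by linarith [Real.pi_gt_three]
    have := frac d hd
    gcongr
  have hYQ : Y ≤ Y * Q := le_mul_of_one_le_right hY hQ'
  linarith

set_option maxHeartbeats 1000000 in
/-- The quantitative heart of the argument: if the inner products `⟨v_i, y⟩`, `⟨v_i', y⟩` are
close to integers in mean square, off a small set of indices, then `y` is small. Here `Q` is the
quality of the simultaneous approximation, `r` the order of the differences, `q` the number of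
blocks and `4 N` the length of the progression. -/
lemma norm_mul_sq_le_of_sum_distInt_le {τ s t : ℝ} {n r Q q N : ℕ} {H Y : ℝ}
    (hD : DiophantineCondition τ n s t) (y : EuclideanSpace ℝ (Fin 4)) (I : Finset (Fin n))
    (hr : 0 < r) (hN : 0 < N) (hQ : 13 ≤ Q) (hQτ : (Q : ℝ) ^ 2 ≤ (n : ℝ) ^ τ)
    (hfit : q * (Q ^ 2 * (4 * N)) ≤ n) (hH : 0 ≤ H) (hq : I.card + H / (1 / (4 * 2 ^ r)) ^ 2 < q)
    (hgap : r + 2 ≤ N * (n : ℝ) ^ (-1 + 8 * τ)) (hY : ‖y‖ ≤ Y)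
    (hsmall : (4 * Real.pi / Q) ^ r * (10 * n * Y * Q) ≤ 1 / 2)
    (hsum : ∑ k ∈ Iᶜ, (distInt (inner ℝ (vecV n (k + 1) s t) y) ^ 2
      + distInt (inner ℝ (vecV' n (k + 1) s t) y) ^ 2) ≤ H) :
    ‖y‖ * N ^ 2 ≤ 6 * n * (3 * 20 ^ (r + 2) * √(4 * N * H)) := by
  have hQ0 : 0 < Q := by omega
  have hQ' : (13 : ℝ) ≤ Q := by exact_mod_cast hQ
  have hpi4 := Real.pi_lt_d2
  have hq0 : 0 < q := by
    have : (0 : ℝ) < q := lt_of_le_of_lt (by positivity) hq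
    exact_mod_cast this
  have hQ2 : 0 < Q ^ 2 := by positivity
  have hNn4 : 4 * N ≤ n :=
    ((Nat.le_mul_of_pos_left _ hQ2).trans (Nat.le_mul_of_pos_left _ hq0)).trans hfit
  have hn : 0 < n := by omega
  have hn' : (0 : ℝ) < n := by exact_mod_cast hn
  have hY0 : 0 ≤ Y := (norm_nonneg y).trans hY
  obtain ⟨d, hd, hdQ, ⟨p₁, hp₁⟩, p₂, hp₂⟩ :=
    exists_simultaneous_approx (t / n / (2 * Real.pi)) (s / n / (2 * Real.pi)) hQ0
  have hdn : d ≤ n := hdQ.trans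
    (((Nat.le_mul_of_pos_right _ (by omega)).trans (Nat.le_mul_of_pos_left _ hq0)).trans hfit)
  set θ₁ : ℝ := d * (t / n) - 2 * Real.pi * p₁ with hθ₁
  set θ₂ : ℝ := d * (s / n) - 2 * Real.pi * p₂ with hθ₂
  set δ : ℝ := 2 * Real.pi / Q with hδ
  have hδ0 : 0 < δ := by positivity
  have hδ1 : δ ≤ 1 / 2 := by rw [hδ, div_le_iff₀ (by positivity)]; linarith
  have hθδ : ∀ (x : ℝ) (p : ℤ), |d * (x / (2 * Real.pi)) - p| ≤ 1 / Q →
      |d * x - 2 * Real.pi * p| ≤ δ := by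
    intro x p h
    have : d * x - 2 * Real.pi * p = 2 * Real.pi * (d * (x / (2 * Real.pi)) - p) := by field_simp
    rw [this, abs_mul, abs_of_pos (by positivity), hδ, ← mul_one_div _ (Q : ℝ)]
    exact mul_le_mul_of_nonneg_left h (by positivity)
  have hθ₁δ : |θ₁| ≤ δ := hθδ _ _ hp₁
  have hθ₂δ : |θ₂| ≤ δ := hθδ _ _ hp₂
  set g : ℝ := (n : ℝ) ^ (-1 + 8 * τ) with hg
  have hg0 : 0 < g := by positivity
  have hdτ : |((d : ℤ) : ℝ)| ≤ (n : ℝ) ^ τ := by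
    rw [Int.cast_natCast, Nat.abs_cast]
    exact le_trans (by exact_mod_cast hdQ) hQτ
  have h0τ : |((0 : ℤ) : ℝ)| ≤ (n : ℝ) ^ τ := by simp; positivity
  have hd0 : (d : ℤ) ≠ 0 := by omega
  have hgθ₁ : g ≤ |θ₁| := by
    simpa [hθ₁] using hD.le_abs hn h0τ hdτ (Or.inr hd0) p₁
  have hgθ₂ : g ≤ |θ₂| := by
    simpa [hθ₂] using hD.le_abs hn hdτ h0τ (Or.inl hd0) p₂
  have hgθ : g ≤ |θ₁ - θ₂| := by
    have h := hD.le_abs hn (k := -d) (l := d) (by simpa using hdτ) hdτ (Or.inr hd0) (p₁ - p₂)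
    convert h using 2
    rw [hθ₁, hθ₂]; push_cast; ring
  -- The steps of the difference operators are `O(1 / g)`, hence fit into the window.
  have hstep : ∀ (h : ℕ) (θ : ℝ), g ≤ |θ| → h * |θ| ≤ 2 → h * g ≤ 2 := fun h θ h1 h2 ↦
    le_trans (by gcongr) h2
  have hfits : ∀ h k : ℕ, h * g ≤ 2 → k * g ≤ 2 → r * h + 2 * k ≤ 2 * N := by
    intro h k hh hk
    have h1 : ((r * h + 2 * k : ℕ) : ℝ) * g ≤ (2 * N : ℕ) * g := by
      push_cast
      have : (r : ℝ) * (h * g) ≤ r * 2 := by gcongr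
      nlinarith
    exact_mod_cast le_of_mul_le_mul_right h1 hg0
  -- `u k` is the squared distance of `⟨v_{k+1}, y⟩ + √-1 ⟨v_{k+1}', y⟩` to the Gaussian integers.
  set u : ℕ → ℝ := fun k ↦ distInt (inner ℝ (vecV n (k + 1) s t) y) ^ 2
      + distInt (inner ℝ (vecV' n (k + 1) s t) y) ^ 2 with hu
  obtain ⟨i₀, hlt, hle, hsumle⟩ := exists_progression_le I (u := u) (fun k ↦ by positivity)
    (H := H) (ε := (1 / (4 * 2 ^ r)) ^ 2) (by positivity) hsum hq hfit hd
    (L := 4 * N) (by gcongr)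
  have hi₀ : i₀ + 1 ≤ n := hlt 0 (by omega)
  set p : ℕ → ℂ := fun j ↦ (round (inner ℝ (vecV n (i₀ + d * j + 1) s t) y : ℝ) : ℂ)
    + (round (inner ℝ (vecV' n (i₀ + d * j + 1) s t) y : ℝ) : ℂ) * Complex.I with hp
  have hpmem : ∀ j, p j ∈ GaussianInt.toComplex.range := fun j ↦
    ⟨⟨round (inner ℝ (vecV n (i₀ + d * j + 1) s t) y : ℝ),
      round (inner ℝ (vecV' n (i₀ + d * j + 1) s t) y : ℝ)⟩, GaussianInt.toComplex_def' _ _⟩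
  set z₁ := Complex.exp (Complex.I * θ₁) with hz₁
  set z₂ := Complex.exp (Complex.I * θ₂) with hz₂
  set e₁ := Complex.exp (Complex.I * ((i₀ + 1 : ℕ) * (t / n) : ℝ)) with he₁
  set e₂ := Complex.exp (Complex.I * ((i₀ + 1 : ℕ) * (s / n) : ℝ)) with he₂
  set A₁ := (y 0 + Complex.I * (y 1 * (((i₀ + 1 : ℕ) : ℂ) / n))) * e₁ with hA₁
  set B₁ := Complex.I * (y 1 * ((d : ℂ) / n)) * e₁ with hB₁
  set A₂ := (y 2 + Complex.I * (y 3 * (((i₀ + 1 : ℕ) : ℂ) / n))) * e₂ with hA₂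
  set B₂ := Complex.I * (y 3 * ((d : ℂ) / n)) * e₂ with hB₂
  have nz₁ : ‖z₁‖ = 1 := Complex.norm_exp_I_mul_ofReal _
  have nz₂ : ‖z₂‖ = 1 := Complex.norm_exp_I_mul_ofReal _
  have ne₁ : ‖e₁‖ = 1 := Complex.norm_exp_I_mul_ofReal _
  have ne₂ : ‖e₂‖ = 1 := Complex.norm_exp_I_mul_ofReal _
  have hF : ∀ j, ‖(linExp A₁ B₁ z₁ + linExp A₂ B₂ z₂ - p) j‖ ^ 2 = u (i₀ + d * j) := by
    intro j
    have e1 : linExp A₁ B₁ z₁ j = _ := linExp_exp_eq (y 0) (y 1) (t / n) n i₀ d j p₁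
    have e2 : linExp A₂ B₂ z₂ j = _ := linExp_exp_eq (y 2) (y 3) (s / n) n i₀ d j p₂
    rw [Pi.sub_apply, Pi.add_apply, e1, e2, ← inner_vecV_add_inner_vecV',
      Complex.sq_norm, Complex.normSq_apply]
    simp only [hp, hu, distInt, sq_abs]
    simp
    ring
  have hF1 : ∀ j < 4 * N, ‖(linExp A₁ B₁ z₁ + linExp A₂ B₂ z₂ - p) j‖ ≤ 1 / (4 * 2 ^ r) := by
    intro j hj
    exact le_of_sq_le_sq (by rw [hF]; exact hle j hj) (by positivity)
  have hFsum : ∑ j ∈ Finset.range (4 * N), ‖(linExp A₁ B₁ z₁ + linExp A₂ B₂ z₂ - p) j‖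
      ≤ √(4 * N * H) := by
    refine Real.le_sqrt_of_sq_le (sq_sum_le_card_mul_sum_sq.trans ?_)
    rw [Finset.card_range, Finset.sum_congr rfl fun j _ ↦ hF j]
    push_cast
    gcongr
  have hp0 : ∀ j, j + r < 4 * N → (twistedDiff 1 1)^[r] p j = 0 := by
    refine twistedDiff_one_iterate_eq_zero nz₁ nz₂ hδ0
      (Real.norm_exp_I_mul_ofReal_sub_one_le.trans hθ₁δ)
      (Real.norm_exp_I_mul_ofReal_sub_one_le.trans hθ₂δ) (P := 5 * Y * Q) ?_ ?_ hpmem hF1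
    · have hyi : ∀ i, |y i| ≤ Y := fun i ↦
        (by simpa using PiLp.norm_apply_le y i : |y i| ≤ ‖y‖).trans hY
      have a₁ := norm_coeff_add_div_le ne₁ hi₀ hdn hn (by omega : 1 ≤ Q) (hyi 0) (hyi 1)
      have a₂ := norm_coeff_add_div_le ne₂ hi₀ hdn hn (by omega : 1 ≤ Q) (hyi 2) (hyi 3)
      calc _ ≤ 5 / 2 * Y * Q + 5 / 2 * Y * Q := add_le_add a₁ a₂
        _ = 5 * Y * Q := by ring
    · refine le_trans ?_ hsmall
      have e : 2 * δ = 4 * Real.pi / Q := by rw [hδ]; ring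
      rw [e]
      have h1 : 1 + δ * (4 * N : ℕ) ≤ 2 * n := by
        have h2 : ((4 * N : ℕ) : ℝ) ≤ n := by exact_mod_cast hNn4
        have h3 : (1 : ℝ) ≤ n := by exact_mod_cast hn
        nlinarith
      calc (4 * Real.pi / Q) ^ r * ((1 + δ * (4 * N : ℕ)) * (5 * Y * Q))
          ≤ (4 * Real.pi / Q) ^ r * (2 * n * (5 * Y * Q)) := by gcongr
        _ = _ := by ring
  -- Steps for which powers of `z₁`, `z₂` separate from `1` and from each other.
  obtain ⟨h₁, hh₁, s₁⟩ := exists_half_le_norm_exp_pow_sub_one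
    (abs_pos.1 (hg0.trans_le hgθ₁)) (hθ₁δ.trans (by linarith))
  obtain ⟨h₂, hh₂, s₂⟩ := exists_half_le_norm_exp_pow_sub_one
    (abs_pos.1 (hg0.trans_le hgθ₂)) (hθ₂δ.trans (by linarith))
  obtain ⟨k, hk, s₃⟩ := exists_half_le_norm_exp_pow_sub_one
    (abs_pos.1 (hg0.trans_le hgθ)) ((abs_sub _ _).trans (by linarith))
  have hz₁₂ : 1 / 2 ≤ ‖z₁ ^ k - z₂ ^ k‖ := by
    have : z₁ ^ k - z₂ ^ k = z₂ ^ k * (Complex.exp (Complex.I * (θ₁ - θ₂ : ℝ)) ^ k - 1) := by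
      rw [mul_sub, mul_one, ← mul_pow, hz₁, hz₂, ← Complex.exp_add]
      congr 3; push_cast; ring
    rw [this, norm_mul, norm_pow, nz₂, one_pow, one_mul]
    exact s₃
  have hNn : N ≤ n := by omega
  have c₁ := coeff_le_of_sum_norm_sub_le nz₁ nz₂
    (hfits h₁ k (hstep _ _ hgθ₁ hh₁) (hstep _ _ hgθ hk)) hr s₁ hz₁₂ hp0 hFsum
  have hFsum' := hFsum
  rw [add_comm (linExp A₁ B₁ z₁)] at hFsum'
  have c₂ := coeff_le_of_sum_norm_sub_le nz₂ nz₁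
    (hfits h₂ k (hstep _ _ hgθ₂ hh₂) (hstep _ _ hgθ hk)) hr s₂ (by rwa [norm_sub_rev]) hp0 hFsum'
  have f₁ := coord_le_of_coeff_le ne₁ hi₀ hd hN hNn c₁
  have f₂ := coord_le_of_coeff_le ne₂ hi₀ hd hN hNn c₂
  calc ‖y‖ * (N : ℝ) ^ 2 ≤ (|y 0| + |y 1| + (|y 2| + |y 3|)) * (N : ℝ) ^ 2 := by
        gcongr; exact norm_le_sum_abs_coord y
    _ ≤ _ := by linarith

lemma eventually_le_natCast_rpow {c : ℝ} (hc : 0 < c) (K : ℝ) :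
    ∀ᶠ n : ℕ in Filter.atTop, K ≤ (n : ℝ) ^ c :=
  ((tendsto_rpow_atTop hc).comp tendsto_natCast_atTop_atTop).eventually_ge_atTop K

set_option maxHeartbeats 800000 in
/-- Under the Diophantine condition the inner products `⟨v_i, y⟩`, `⟨v_i', y⟩` are, in mean
square, far from the integers, for `y` neither too short nor too long. -/
theorem exists_forall_lt_sum_distInt {C τ : ℝ} (hC : 0 < C) (hτ : 0 < τ) (hτ1 : τ < 1 / 16)
    (m : ℕ) : ∃ n₀ : ℕ, ∀ n ≥ n₀, ∀ s t : ℝ, DiophantineCondition τ n s t →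
      ∀ y : EuclideanSpace ℝ (Fin 4), (n : ℝ) ^ (4 * τ - 1 / 2) ≤ ‖y‖ → ‖y‖ ≤ (n : ℝ) ^ (C + 1) →
      ∀ I : Finset (Fin n), I.card ≤ m →
      (n : ℝ) ^ (τ / 10) < ∑ k ∈ Iᶜ, (distInt (inner ℝ (vecV n (k + 1) s t) y) ^ 2
        + distInt (inner ℝ (vecV' n (k + 1) s t) y) ^ 2) := by
  -- Each of the `r` differences gains a factor of order `n ^ (-τ / 2)`; together they have to
  -- beat the size of the coefficients and the length of the progression.
  obtain ⟨r, hr0, hrτ⟩ : ∃ r : ℕ, 0 < r ∧ C + 4 ≤ r * (τ / 2) := by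
    refine ⟨⌈2 * (C + 4) / τ⌉₊, Nat.ceil_pos.2 (by positivity), ?_⟩
    have := Nat.le_ceil (2 * (C + 4) / τ)
    rw [div_le_iff₀ hτ] at this
    linarith
  obtain ⟨K, hK⟩ : ∃ K : ℝ, K = 3 * 20 ^ (r + 2) := ⟨_, rfl⟩
  obtain ⟨E, hE⟩ : ∃ E : ℝ, E = ((1 / (4 * 2 ^ r)) ^ 2)⁻¹ := ⟨_, rfl⟩
  have hE0 : 0 < E := by rw [hE]; positivity
  obtain ⟨n₀, hn₀⟩ := Filter.eventually_atTop.1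
    ((eventually_le_natCast_rpow (c := τ / 2) (by linarith) 14).and
    ((eventually_le_natCast_rpow (c := τ / 4) (by linarith) 4).and
    ((eventually_le_natCast_rpow (c := 3 * τ / 20) (by linarith) (m + 2 + E)).and
    ((eventually_le_natCast_rpow (c := 1 - 3 * τ / 2) (by linarith) 2).and
    ((eventually_le_natCast_rpow (c := 13 * τ / 2) (by linarith) (2 * (r + 2))).and
    ((eventually_le_natCast_rpow (c := 1) (by linarith) (20 * (8 * Real.pi) ^ r)).and
    ((eventually_le_natCast_rpow (c := 17 * τ / 5) (by linarith) (1152 * K ^ 2 + 1)).and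
    (Filter.eventually_ge_atTop 1))))))))
  refine ⟨n₀, fun n hn s t hD y hy1 hy2 I hI ↦ ?_⟩
  obtain ⟨ha, hc, hd, hN2, he, hf, hg, hn1⟩ := hn₀ n hn
  set x : ℝ := (n : ℝ) with hx
  have hx1 : 1 ≤ x := by rw [hx]; exact_mod_cast hn1
  have hx0 : 0 < x := by linarith
  by_contra! hsum
  -- `Q ^ 2 ≤ n ^ τ` keeps the step within the range of the Diophantine condition. There are at
  -- most `m + E n ^ (τ / 10) < q` bad indices, and `N` is what then fits into a block.
  set Q := ⌊x ^ (τ / 2)⌋₊ with hQ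
  set q := ⌊x ^ (τ / 4)⌋₊ with hq
  set N := ⌊x ^ (1 - 3 * τ / 2)⌋₊ with hN
  have hQle : (Q : ℝ) ≤ x ^ (τ / 2) := Nat.floor_le (by positivity)
  have hqle : (q : ℝ) ≤ x ^ (τ / 4) := Nat.floor_le (by positivity)
  have hNle : (N : ℝ) ≤ x ^ (1 - 3 * τ / 2) := Nat.floor_le (by positivity)
  have hQge : x ^ (τ / 2) / 2 ≤ Q := by
    have := Nat.lt_floor_add_one (x ^ (τ / 2)); rw [← hQ] at this; linarith
  have hqge : x ^ (τ / 4) - 1 < q := by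
    have := Nat.lt_floor_add_one (x ^ (τ / 4)); rw [← hq] at this; linarith
  have hNge : x ^ (1 - 3 * τ / 2) / 2 ≤ N := by
    have := Nat.lt_floor_add_one (x ^ (1 - 3 * τ / 2)); rw [← hN] at this; linarith
  have hN0 : 0 < N := Nat.floor_pos.2 (by linarith)
  have hQ13 : 13 ≤ Q := Nat.le_floor (by push_cast; linarith)
  have hN0' : (0 : ℝ) < N := by exact_mod_cast hN0
  have hQ0' : (0 : ℝ) < Q := by exact_mod_cast (by omega : 0 < Q)
  have hQτ : (Q : ℝ) ^ 2 ≤ x ^ τ := by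
    calc (Q : ℝ) ^ 2 ≤ (x ^ (τ / 2)) ^ 2 := by gcongr
      _ = x ^ τ := by rw [← Real.rpow_mul_natCast hx0.le]; congr 1; push_cast; ring
  have hfit : q * (Q ^ 2 * (4 * N)) ≤ n := by
    have : (q : ℝ) * ((Q : ℝ) ^ 2 * (4 * N)) ≤ x := by
      calc (q : ℝ) * ((Q : ℝ) ^ 2 * (4 * N))
          ≤ x ^ (τ / 4) * (x ^ τ * (x ^ (τ / 4) * x ^ (1 - 3 * τ / 2))) := by gcongr
        _ = x := by
          rw [← Real.rpow_add hx0, ← Real.rpow_add hx0, ← Real.rpow_add hx0]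
          conv_rhs => rw [← Real.rpow_one x]
          congr 1; ring
    rw [hx] at this
    exact_mod_cast this
  have hH1 : 1 ≤ x ^ (τ / 10) := Real.one_le_rpow hx1 (by positivity)
  have hqH : I.card + x ^ (τ / 10) / (1 / (4 * 2 ^ r)) ^ 2 < q := by
    have hI' : (I.card : ℝ) ≤ m := by exact_mod_cast hI
    have h1 : x ^ (τ / 4) = x ^ (3 * τ / 20) * x ^ (τ / 10) := by
      rw [← Real.rpow_add hx0]; congr 1; ring
    have h2 : (m + 2 + E) * x ^ (τ / 10) ≤ x ^ (τ / 4) := by rw [h1]; gcongr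
    rw [div_eq_mul_inv, ← hE]
    nlinarith
  have hgap : r + 2 ≤ N * x ^ (-1 + 8 * τ) := by
    calc (r : ℝ) + 2 ≤ x ^ (13 * τ / 2) / 2 := by linarith
      _ = x ^ (1 - 3 * τ / 2) / 2 * x ^ (-1 + 8 * τ) := by
        rw [div_mul_eq_mul_div, ← Real.rpow_add hx0]; congr 2; ring
      _ ≤ _ := by gcongr
  have hsmall : (4 * Real.pi / Q) ^ r * (10 * x * x ^ (C + 1) * Q) ≤ 1 / 2 := by
    have hpi := Real.pi_pos
    have h1 : 4 * Real.pi / Q ≤ 8 * Real.pi * x ^ (-(τ / 2)) := by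
      rw [Real.rpow_neg hx0.le, ← div_eq_mul_inv, div_le_div_iff₀ hQ0' (by positivity)]
      nlinarith
    have h2 : (x ^ (-(τ / 2))) ^ r ≤ x ^ (-(C + 4)) := by
      rw [← Real.rpow_mul_natCast hx0.le]
      exact Real.rpow_le_rpow_of_exponent_le hx1 (by linarith)
    rw [Real.rpow_one] at hf
    calc (4 * Real.pi / Q) ^ r * (10 * x * x ^ (C + 1) * Q)
        ≤ (8 * Real.pi * x ^ (-(τ / 2))) ^ r * (10 * x * x ^ (C + 1) * x ^ (τ / 2)) := by gcongr
      _ ≤ (8 * Real.pi) ^ r * x ^ (-(C + 4)) * (10 * x * x ^ (C + 1) * x ^ (1 : ℝ)) := by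
          rw [mul_pow]
          gcongr
          linarith
      _ = 10 * (8 * Real.pi) ^ r
            * (x ^ (-(C + 4)) * (x ^ (1 : ℝ) * x ^ (C + 1) * x ^ (1 : ℝ))) := by
          rw [Real.rpow_one]; ring
      _ = 10 * (8 * Real.pi) ^ r * x⁻¹ := by
          rw [← Real.rpow_add hx0, ← Real.rpow_add hx0, ← Real.rpow_add hx0, ← Real.rpow_neg_one]
          congr 2; ring
      _ ≤ 1 / 2 := by
          rw [← div_eq_mul_inv, div_le_iff₀ hx0]; linarith
  have hmain := norm_mul_sq_le_of_sum_distInt_le hD y I hr0 hN0 hQ13 hQτ hfit (by positivity) hqH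
    hgap hy2 hsmall hsum
  rw [← hK, ← hx] at hmain
  have hsq : ‖y‖ ^ 2 * N ^ 3 ≤ 144 * K ^ 2 * (x ^ (2 : ℝ) * x ^ (τ / 10)) := by
    have h1 : (‖y‖ * N ^ 2) ^ 2 ≤ (6 * x * (K * √(4 * N * x ^ (τ / 10)))) ^ 2 := by gcongr
    have h2 : (6 * x * (K * √(4 * N * x ^ (τ / 10)))) ^ 2
        = 144 * K ^ 2 * (x ^ 2 * x ^ (τ / 10)) * N := by
      rw [mul_pow, mul_pow, mul_pow, Real.sq_sqrt (by positivity)]; ring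
    rw [h2] at h1
    rw [Real.rpow_two]
    refine le_of_mul_le_mul_right (le_trans (le_of_eq ?_) h1) hN0'
    ring
  have hlow : x ^ (2 : ℝ) * x ^ (τ / 10) * x ^ (17 * τ / 5) / 8 ≤ ‖y‖ ^ 2 * N ^ 3 := by
    have h1 : (x ^ (4 * τ - 1 / 2)) ^ 2 = x ^ (8 * τ - 1) := by
      rw [← Real.rpow_mul_natCast hx0.le]; congr 1; push_cast; ring
    have h2 : (x ^ (1 - 3 * τ / 2)) ^ 3 = x ^ (3 - 9 * τ / 2) := by
      rw [← Real.rpow_mul_natCast hx0.le]; congr 1; push_cast; ring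
    have h3 : x ^ (2 : ℝ) * x ^ (τ / 10) * x ^ (17 * τ / 5)
        = x ^ (8 * τ - 1) * x ^ (3 - 9 * τ / 2) := by
      rw [← Real.rpow_add hx0, ← Real.rpow_add hx0, ← Real.rpow_add hx0]; congr 1; ring
    calc x ^ (2 : ℝ) * x ^ (τ / 10) * x ^ (17 * τ / 5) / 8
        = (x ^ (4 * τ - 1 / 2)) ^ 2 * (x ^ (1 - 3 * τ / 2) / 2) ^ 3 := by
          rw [h3, h1, div_pow, h2]; ring
      _ ≤ ‖y‖ ^ 2 * N ^ 3 :=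
          mul_le_mul (pow_le_pow_left₀ (by positivity) hy1 2)
            (pow_le_pow_left₀ (by positivity) hNge 3) (by positivity) (by positivity)
  have hpos : 0 < x ^ (2 : ℝ) * x ^ (τ / 10) := by positivity
  have hcontra := mul_le_mul_of_nonneg_left hg hpos.le
  linarith [hlow.trans hsq]

/-! ### Characteristic functions of standardized laws -/

lemma cos_two_pi_mul_le (v : ℝ) : Real.cos (2 * Real.pi * v) ≤ 1 - 8 * distInt v ^ 2 := by
  have h1 : Real.cos (2 * Real.pi * v) = Real.cos (2 * Real.pi * (v - round v)) := by
    rw [mul_sub, mul_comm (2 * Real.pi) (round v : ℝ), Real.cos_sub_int_mul_two_pi]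
  have h2 : |2 * Real.pi * (v - round v)| ≤ Real.pi := by
    rw [abs_mul, abs_of_pos Real.two_pi_pos]
    nlinarith [abs_sub_round v, Real.pi_pos]
  have h3 := Real.cos_le_one_sub_mul_cos_sq h2
  have h4 : 2 / Real.pi ^ 2 * (2 * Real.pi * (v - round v)) ^ 2 = 8 * distInt v ^ 2 := by
    rw [distInt, sq_abs]; field_simp; ring
  rw [h1]; linarith

lemma measurable_distInt : Measurable distInt := by
  unfold distInt
  simp only [round_eq]
  fun_prop

lemma distInt_sq_le_one (v : ℝ) : distInt v ^ 2 ≤ 1 := by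
  have h1 := abs_sub_round v
  have h2 := abs_nonneg (v - round v)
  unfold distInt
  nlinarith

lemma integrable_distInt_sq {X : Type*} [MeasurableSpace X] (ν : Measure X) [IsFiniteMeasure ν]
    {f : X → ℝ} (hf : Measurable f) : Integrable (fun p ↦ distInt (f p) ^ 2) ν := by
  refine Integrable.of_bound ((measurable_distInt.comp hf).pow_const 2).aestronglyMeasurable 1 ?_
  filter_upwards with p
  rw [Real.norm_eq_abs, abs_of_nonneg (sq_nonneg _)]
  exact distInt_sq_le_one _

lemma norm_charFun_sq_eq (μ : Measure ℝ) [IsProbabilityMeasure μ] (u : ℝ) :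
    ‖charFun μ u‖ ^ 2 = ∫ p, Real.cos (u * (p.1 - p.2)) ∂(μ.prod μ) := by
  have h1 : ((‖charFun μ u‖ ^ 2 : ℝ) : ℂ) =
      ∫ p, Complex.exp (Complex.I * (u * (p.1 - p.2) : ℝ)) ∂(μ.prod μ) := by
    push_cast
    rw [← Complex.mul_conj', ← charFun_neg, charFun_apply_real, charFun_apply_real,
      ← integral_prod_mul]
    refine integral_congr_ae (Filter.Eventually.of_forall fun p ↦ ?_)
    simp only
    rw [← Complex.exp_add]
    congr 1; push_cast; ring
  have hint : Integrable (fun p : ℝ × ℝ ↦ Complex.exp (Complex.I * (u * (p.1 - p.2) : ℝ)))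
      (μ.prod μ) := by
    refine Integrable.of_bound (by fun_prop) 1 ?_
    filter_upwards with p
    rw [Complex.norm_exp_I_mul_ofReal]
  have h2 := congrArg Complex.re h1
  rw [Complex.ofReal_re] at h2
  rw [h2, ← Complex.reCLM_apply, ← Complex.reCLM.integral_comp_comm hint]
  refine integral_congr_ae (Filter.Eventually.of_forall fun p ↦ ?_)
  simp only [Complex.reCLM_apply]
  rw [mul_comm, Complex.exp_ofReal_mul_I_re]

/-- The characteristic function is controlled by the distance to the integers of multiples of
the symmetrized variable. -/
lemma norm_charFun_le_exp (μ : Measure ℝ) [IsProbabilityMeasure μ] (u : ℝ) :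
    ‖charFun μ u‖ ≤
      Real.exp (-4 * ∫ p, distInt ((p.1 - p.2) / (2 * Real.pi) * u) ^ 2 ∂(μ.prod μ)) := by
  have hint := integrable_distInt_sq (μ.prod μ)
    (f := fun p : ℝ × ℝ ↦ (p.1 - p.2) / (2 * Real.pi) * u) (by fun_prop)
  have hcos : Integrable (fun p : ℝ × ℝ ↦ Real.cos (u * (p.1 - p.2))) (μ.prod μ) := by
    refine Integrable.of_bound (by fun_prop) 1 ?_
    filter_upwards with p
    exact Real.abs_cos_le_one _
  have h1 : ‖charFun μ u‖ ^ 2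
      ≤ 1 - 8 * ∫ p, distInt ((p.1 - p.2) / (2 * Real.pi) * u) ^ 2 ∂(μ.prod μ) := by
    rw [norm_charFun_sq_eq, ← integral_const_mul]
    have hone : (1 : ℝ) = ∫ _p : ℝ × ℝ, (1 : ℝ) ∂(μ.prod μ) := by simp
    conv_rhs => rw [hone]
    rw [← integral_sub (integrable_const _) (hint.const_mul _)]
    refine integral_mono hcos ((integrable_const _).sub (hint.const_mul _)) fun p ↦ ?_
    refine le_trans (le_of_eq ?_) (cos_two_pi_mul_le _)
    congr 1; field_simp
  refine le_of_sq_le_sq (h1.trans ?_) (Real.exp_pos _).le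
  rw [← Real.exp_nat_mul]
  refine le_trans (le_of_eq ?_) (Real.add_one_le_exp _)
  push_cast; ring

lemma IsStandardizedLaw.integral_sq {μ : Measure ℝ} (hμ : IsStandardizedLaw μ) :
    ∫ a, a ^ 2 ∂μ = 1 := by
  have := hμ.isProbabilityMeasure
  have h := hμ.variance_eq_one
  rw [variance_of_integral_eq_zero aemeasurable_id (by simpa using hμ.mean_eq_zero)] at h
  simpa using h

lemma IsStandardizedLaw.integrable_sq {μ : Measure ℝ} (hμ : IsStandardizedLaw μ) :
    Integrable (fun a ↦ a ^ 2) μ := by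
  simpa using hμ.memLp.integrable_sq

lemma measurableSet_one_le_abs_sub_le (K : ℝ) :
    MeasurableSet {p : ℝ × ℝ | 1 ≤ |p.1 - p.2| ∧ |p.1 - p.2| ≤ K} :=
  (measurableSet_le (f := fun _ ↦ 1) (g := fun p : ℝ × ℝ ↦ |p.1 - p.2|)
      (by fun_prop) (by fun_prop)).inter
    (measurableSet_le (f := fun p : ℝ × ℝ ↦ |p.1 - p.2|) (g := fun _ ↦ K)
      (by fun_prop) (by fun_prop))

/-- If large values of a standardized law contribute little to its variance, then the
symmetrized variable has absolute value in `[1, 2 R]` with probability bounded below. -/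
lemma IsStandardizedLaw.le_measureReal_sub_mem {μ : Measure ℝ} (hμ : IsStandardizedLaw μ) {R : ℝ}
    (hR : 1 ≤ R) (htail : ∫ a in {a | R < |a|}, a ^ 2 ∂μ ≤ 1 / 16) :
    1 / (8 * R ^ 2) ≤ (μ.prod μ).real {p | 1 ≤ |p.1 - p.2| ∧ |p.1 - p.2| ≤ 2 * R} := by
  have := hμ.isProbabilityMeasure
  set S : Set (ℝ × ℝ) := {p | 1 ≤ |p.1 - p.2| ∧ |p.1 - p.2| ≤ 2 * R} with hS
  have hSm : MeasurableSet S := measurableSet_one_le_abs_sub_le _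
  set T : Set ℝ := {a | R < |a|} with hT
  have hTm : MeasurableSet T := measurableSet_lt (by fun_prop) (by fun_prop)
  set f : ℝ → ℝ := T.indicator (fun a ↦ a ^ 2) with hf
  have hsq := hμ.integrable_sq
  have hid : Integrable (fun a : ℝ ↦ a) μ := hμ.memLp.integrable one_le_two
  have hfi : Integrable f μ := hsq.indicator hTm
  have hfint : ∫ a, f a ∂μ ≤ 1 / 16 := by rw [hf, integral_indicator hTm]; exact htail
  have e1 : ∀ g : ℝ → ℝ, ∫ p, g p.1 ∂(μ.prod μ) = ∫ a, g a ∂μ := fun g ↦ by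
    simpa using integral_fun_fst (μ := μ) (ν := μ) g
  have e2 : ∀ g : ℝ → ℝ, ∫ p, g p.2 ∂(μ.prod μ) = ∫ a, g a ∂μ := fun g ↦ by
    simpa using integral_fun_snd (μ := μ) (ν := μ) g
  have hadd : Integrable (fun p : ℝ × ℝ ↦ p.1 ^ 2 + p.2 ^ 2) (μ.prod μ) :=
    (hsq.comp_fst μ).add (hsq.comp_snd μ)
  have hmul : Integrable (fun p : ℝ × ℝ ↦ 2 * (p.1 * p.2)) (μ.prod μ) :=
    (hid.mul_prod hid).const_mul 2
  have hw : ∫ p, (p.1 ^ 2 + p.2 ^ 2 - 2 * (p.1 * p.2)) ∂(μ.prod μ) = 2 := by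
    rw [integral_sub hadd hmul,
      integral_add (hsq.comp_fst μ) (hsq.comp_snd μ), integral_const_mul,
      integral_prod_mul (fun a ↦ a) (fun a ↦ a), e1 (fun a ↦ a ^ 2), e2 (fun a ↦ a ^ 2),
      hμ.mean_eq_zero, hμ.integral_sq]
    norm_num
  have hSi : Integrable (S.indicator fun _ ↦ (4 * R ^ 2 : ℝ)) (μ.prod μ) :=
    (integrable_const _).indicator hSm
  have hadd₁ : Integrable (fun p ↦ 1 + S.indicator (fun _ ↦ (4 * R ^ 2 : ℝ)) p) (μ.prod μ) :=
    (integrable_const _).add hSi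
  have hadd₂ : Integrable (fun p : ℝ × ℝ ↦ 4 * f p.1 + 4 * f p.2) (μ.prod μ) :=
    ((hfi.comp_fst μ).const_mul 4).add ((hfi.comp_snd μ).const_mul 4)
  have hle : ∫ p, (p.1 ^ 2 + p.2 ^ 2 - 2 * (p.1 * p.2)) ∂(μ.prod μ) ≤
      ∫ p, (1 + S.indicator (fun _ ↦ (4 * R ^ 2 : ℝ)) p + (4 * f p.1 + 4 * f p.2)) ∂(μ.prod μ) := by
    refine integral_mono
      (hadd.sub hmul) (hadd₁.add hadd₂) fun p ↦ ?_
    -- If `|a - b| > 2 R`, the larger of `|a|`, `|b|` exceeds `R` and is at least `|a - b| / 2`.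
    obtain ⟨a, b⟩ := p
    have hf0 : ∀ a, 0 ≤ f a := fun a ↦ Set.indicator_nonneg (fun a _ ↦ sq_nonneg a) a
    have hS0 : 0 ≤ S.indicator (fun _ ↦ (4 * R ^ 2 : ℝ)) (a, b) :=
      Set.indicator_nonneg (fun _ _ ↦ by positivity) _
    have hfa := hf0 a
    have hfb := hf0 b
    have hsqw : a ^ 2 + b ^ 2 - 2 * (a * b) = |a - b| ^ 2 := by rw [sq_abs]; ring
    simp only
    rw [hsqw]
    have habs := abs_sub a b
    have hw0 := abs_nonneg (a - b)
    by_cases h1 : |a - b| < 1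
    · nlinarith
    by_cases h2 : |a - b| ≤ 2 * R
    · have : S.indicator (fun _ ↦ (4 * R ^ 2 : ℝ)) (a, b) = 4 * R ^ 2 :=
        Set.indicator_of_mem (show (a, b) ∈ S from ⟨not_lt.1 h1, h2⟩) _
      nlinarith
    push Not at h1 h2
    rcases le_total |a| |b| with hab | hab
    · have : f b = |b| ^ 2 := by
        rw [sq_abs]; exact Set.indicator_of_mem (show b ∈ T by show R < |b|; linarith) _
      nlinarith [abs_nonneg a]
    · have : f a = |a| ^ 2 := by
        rw [sq_abs]; exact Set.indicator_of_mem (show a ∈ T by show R < |a|; linarith) _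
      nlinarith [abs_nonneg b]
  rw [hw, integral_add hadd₁ hadd₂,
    integral_add (integrable_const _) hSi,
    integral_add ((hfi.comp_fst μ).const_mul 4) ((hfi.comp_snd μ).const_mul 4),
    integral_const_mul, integral_const_mul, e1 f, e2 f, integral_indicator hSm] at hle
  simp only [integral_const, measureReal_restrict_apply_univ, probReal_univ, smul_eq_mul] at hle
  rw [div_le_iff₀ (by positivity)]
  linarith

lemma IsStandardizedLaw.exists_tail_le {μ : Measure ℝ} (hμ : IsStandardizedLaw μ) :
    ∃ R : ℝ, 1 ≤ R ∧ ∫ a in {a | R < |a|}, a ^ 2 ∂μ ≤ 1 / 16 := by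
  have h := tendsto_setIntegral_of_antitone (μ := μ) (f := fun a : ℝ ↦ a ^ 2)
    (s := fun k : ℕ ↦ {a : ℝ | (k : ℝ) < |a|})
    (fun k ↦ measurableSet_lt (by fun_prop) (by fun_prop))
    (fun k l hkl a (ha : (l : ℝ) < |a|) ↦ lt_of_le_of_lt (Nat.cast_le.2 hkl) ha)
    ⟨0, hμ.integrable_sq.integrableOn⟩
  have hempty : ⋂ k : ℕ, {a : ℝ | (k : ℝ) < |a|} = ∅ := by
    ext a
    simp only [Set.mem_iInter, Set.mem_ofPred_eq, Set.mem_empty_iff_false, iff_false, not_forall,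
      not_lt]
    exact exists_nat_ge |a|
  rw [hempty, Measure.restrict_empty, integral_zero_measure] at h
  obtain ⟨k, hk, hk1⟩ := ((h.eventually_le_const (by norm_num : (0 : ℝ) < 1 / 16)).and
    (Filter.eventually_ge_atTop 1)).exists
  exact ⟨k, by exact_mod_cast hk1, hk⟩

lemma exists_forall_tail_le {ε : ℝ} (hε : 0 < ε) (M : ℝ) :
    ∃ R : ℝ, 1 ≤ R ∧ ∀ μ : Measure ℝ, IsStandardizedLaw μ →
      Integrable (fun a : ℝ ↦ |a| ^ (2 + ε)) μ → ∫ a, |a| ^ (2 + ε) ∂μ ≤ M →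
      ∫ a in {a | R < |a|}, a ^ 2 ∂μ ≤ 1 / 16 := by
  obtain ⟨R, hRM, hR⟩ := (((tendsto_rpow_atTop hε).eventually_ge_atTop (16 * M)).and
    (Filter.eventually_ge_atTop 1)).exists
  refine ⟨R, hR, fun μ hμ hint hM ↦ ?_⟩
  have hRε : 0 < R ^ ε := by positivity
  have hTm : MeasurableSet {a : ℝ | R < |a|} := measurableSet_lt (by fun_prop) (by fun_prop)
  have h1 : ∫ a in {a | R < |a|}, a ^ 2 ∂μ ≤ ∫ a in {a | R < |a|}, |a| ^ (2 + ε) / R ^ ε ∂μ := by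
    refine setIntegral_mono_on hμ.integrable_sq.integrableOn (hint.div_const _).integrableOn hTm
      fun a ha ↦ ?_
    have ha' : R < |a| := ha
    have ha0 : 0 < |a| := by linarith
    rw [le_div_iff₀ hRε, Real.rpow_add ha0, Real.rpow_two, sq_abs]
    gcongr
  have h2 : ∫ a in {a | R < |a|}, |a| ^ (2 + ε) / R ^ ε ∂μ ≤ ∫ a, |a| ^ (2 + ε) / R ^ ε ∂μ :=
    setIntegral_le_integral (hint.div_const _)
      (Filter.Eventually.of_forall fun a ↦ by positivity)
  refine h1.trans (h2.trans ?_)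
  rw [integral_div, div_le_iff₀ hRε]
  linarith

/-! ### The characteristic function of the walk -/

section Walk

variable {Ω : Type*} [MeasurableSpace Ω] {P : Measure Ω} {μ : Measure ℝ} {n : ℕ}
  {y : Fin n → Fin 2 → Ω → ℝ}

lemma integral_exp_eq_charFun {X : Ω → ℝ} (hX : HasLaw X μ P) (c : ℝ) :
    ∫ ω, Complex.exp (Complex.I * ((X ω * c : ℝ) : ℂ)) ∂P = charFun μ c := by
  rw [charFun_apply_real, ← hX.map_eq, integral_map hX.aemeasurable (by fun_prop)]
  refine integral_congr_ae (Filter.Eventually.of_forall fun ω ↦ ?_)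
  simp only
  congr 1; push_cast; ring

lemma IsIIDArray.phiFactor_eq (hy : IsIIDArray P μ y) (s t : ℝ) (k : Fin n)
    (x : EuclideanSpace ℝ (Fin 4)) :
    phiFactor P s t y k x = charFun μ (inner ℝ (vecV n (k + 1) s t) x)
      * charFun μ (inner ℝ (vecV' n (k + 1) s t) x) := by
  rw [phiFactor, integral_exp_eq_charFun (hy.hasLaw k 0), integral_exp_eq_charFun (hy.hasLaw k 1)]

lemma IsIIDArray.charFun_map_randomWalk (hy : IsIIDArray P μ y) (s t : ℝ)
    (x : EuclideanSpace ℝ (Fin 4)) :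
    charFun (P.map (randomWalk s t y)) x = phiR4 P s t y x := by
  let v : Fin n × Fin 2 → EuclideanSpace ℝ (Fin 4) := fun p ↦
    if p.2 = 0 then vecV n (p.1 + 1) s t else vecV' n (p.1 + 1) s t
  let X : Fin n × Fin 2 → Ω → EuclideanSpace ℝ (Fin 4) := fun p ω ↦ y p.1 p.2 ω • v p
  have hX : iIndepFun X P := hy.indep.comp (fun p a ↦ a • v p) fun p ↦ by fun_prop
  have hXm : ∀ p, AEMeasurable (X p) P := fun p ↦
    (hy.hasLaw p.1 p.2).aemeasurable.smul_const _
  have hwalk : randomWalk s t y = fun ω ↦ ∑ p, X p ω := by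
    funext ω
    rw [randomWalk, Fintype.sum_prod_type]
    simp [X, v, Fin.sum_univ_two]
  have hchar : ∀ p, charFun (P.map (X p)) x = charFun μ (inner ℝ (v p) x) := by
    intro p
    rw [← integral_exp_eq_charFun (hy.hasLaw p.1 p.2), charFun_apply,
      integral_map (hXm p) (by fun_prop)]
    refine integral_congr_ae (Filter.Eventually.of_forall fun ω ↦ ?_)
    simp only [X]
    rw [real_inner_smul_left, mul_comm]
  rw [hwalk, hX.charFun_map_fun_sum_eq_prod hXm, Finset.prod_apply, Fintype.prod_prod_type, phiR4]
  refine Finset.prod_congr rfl fun k _ ↦ ?_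
  rw [hy.phiFactor_eq, Fin.prod_univ_two, hchar, hchar]
  simp [v]

/-- A lower bound for the mean square distance to the integers, for all multiples of `x` by a
set of values of the symmetrized variable, bounds the product of the `φ_i(x)`. -/
lemma IsIIDArray.norm_prod_phiFactor_le [IsProbabilityMeasure μ] (hy : IsIIDArray P μ y)
    (s t : ℝ) (x : EuclideanSpace ℝ (Fin 4)) (J : Finset (Fin n)) {S : Set (ℝ × ℝ)}
    (hS : MeasurableSet S) {H : ℝ}
    (hH : ∀ p ∈ S, H ≤
      ∑ k ∈ J, (distInt (inner ℝ (vecV n (k + 1) s t) (((p.1 - p.2) / (2 * Real.pi)) • x)) ^ 2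
        + distInt (inner ℝ (vecV' n (k + 1) s t) (((p.1 - p.2) / (2 * Real.pi)) • x)) ^ 2)) :
    ‖∏ k ∈ J, phiFactor P s t y k x‖ ≤ Real.exp (-4 * ((μ.prod μ).real S * H)) := by
  set D : ℝ → ℝ × ℝ → ℝ := fun c p ↦ distInt ((p.1 - p.2) / (2 * Real.pi) * c) ^ 2 with hD
  have hDint : ∀ c, Integrable (D c) (μ.prod μ) := fun c ↦
    integrable_distInt_sq _ (by fun_prop)
  set F : ℝ × ℝ → ℝ := fun p ↦ ∑ k ∈ J, (D (inner ℝ (vecV n (k + 1) s t) x) p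
    + D (inner ℝ (vecV' n (k + 1) s t) x) p) with hF
  have hDadd : ∀ k : Fin n, Integrable (fun p ↦ D (inner ℝ (vecV n (k + 1) s t) x) p
      + D (inner ℝ (vecV' n (k + 1) s t) x) p) (μ.prod μ) := fun k ↦ (hDint _).add (hDint _)
  have hFint : Integrable F (μ.prod μ) := integrable_finsetSum _ fun k _ ↦ hDadd k
  have hF0 : ∀ p, 0 ≤ F p := fun p ↦ Finset.sum_nonneg fun k _ ↦ by positivity
  have hprod : ‖∏ k ∈ J, phiFactor P s t y k x‖ ≤ Real.exp (-4 * ∫ p, F p ∂(μ.prod μ)) := by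
    rw [norm_prod, integral_finsetSum _ fun k _ ↦ hDadd k, Finset.mul_sum, Real.exp_sum]
    refine Finset.prod_le_prod (fun _ _ ↦ norm_nonneg _) fun k _ ↦ ?_
    rw [hy.phiFactor_eq, norm_mul, integral_add (hDint _) (hDint _), mul_add, Real.exp_add]
    exact mul_le_mul (norm_charFun_le_exp μ _) (norm_charFun_le_exp μ _) (norm_nonneg _)
      (Real.exp_pos _).le
  have hlow : (μ.prod μ).real S * H ≤ ∫ p, F p ∂(μ.prod μ) := by
    calc (μ.prod μ).real S * H = ∫ _p in S, H ∂(μ.prod μ) := by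
          rw [setIntegral_const, smul_eq_mul]
      _ ≤ ∫ p in S, F p ∂(μ.prod μ) := by
          refine setIntegral_mono_on (integrable_const _).integrableOn hFint.integrableOn hS
            fun p hp ↦ (hH p hp).trans (le_of_eq ?_)
          simp only [hF, hD, real_inner_smul_right]
      _ ≤ _ := setIntegral_le_integral hFint (Filter.Eventually.of_forall hF0)
  refine hprod.trans (Real.exp_le_exp.2 ?_)
  linarith

end Walk

/-! ### Decay of the characteristic function -/

lemma exists_forall_fourierDecay {C τ σ : ℝ} (hC : 0 < C) (hτ : 0 < τ) (hτ1 : τ < 1 / 16)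
    (hσ : σ < τ / 10) (m : ℕ) {R : ℝ} (hR : 1 ≤ R) :
    ∃ N : ℕ, ∀ μ : Measure ℝ, IsStandardizedLaw μ → ∫ a in {a | R < |a|}, a ^ 2 ∂μ ≤ 1 / 16 →
      ∀ n : ℕ, N ≤ n → FourierDecay.{u} C τ σ m n μ := by
  obtain ⟨n₀, hn₀⟩ := exists_forall_lt_sum_distInt hC hτ hτ1 m
  obtain ⟨n₁, hn₁⟩ := Filter.eventually_atTop.1
    ((eventually_le_natCast_rpow hτ (2 * Real.pi)).and
    ((eventually_le_natCast_rpow one_pos R).and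
    ((eventually_le_natCast_rpow (sub_pos.2 hσ) (2 * R ^ 2)).and (Filter.eventually_ge_atTop 1))))
  refine ⟨max n₀ n₁, fun μ hμ htail n hn s t hst Ω _ P _ y hy x hx1 hx2 ↦ ?_⟩
  have := hμ.isProbabilityMeasure
  obtain ⟨hτn, hRn, hσn, hn1⟩ := hn₁ n ((le_max_right _ _).trans hn)
  have hn0 : (0 : ℝ) < n := by exact_mod_cast hn1
  have hpi := Real.pi_gt_three
  have key : ∀ I : Finset (Fin n), I.card ≤ m →
      ‖∏ k ∈ Iᶜ, phiFactor P s t y k x‖ ≤ Real.exp (-(n : ℝ) ^ σ) := by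
    intro I hI
    have hbound := hy.norm_prod_phiFactor_le s t x Iᶜ (measurableSet_one_le_abs_sub_le (2 * R))
      (H := (n : ℝ) ^ (τ / 10))
      (fun p hp ↦ (hn₀ n ((le_max_left _ _).trans hn) s t hst _ ?_ ?_ I hI).le)
    · refine hbound.trans (Real.exp_le_exp.2 ?_)
      have hmass := hμ.le_measureReal_sub_mem hR htail
      have h1 : 2 * R ^ 2 * (n : ℝ) ^ σ ≤ (n : ℝ) ^ (τ / 10) := by
        calc 2 * R ^ 2 * (n : ℝ) ^ σ ≤ (n : ℝ) ^ (τ / 10 - σ) * (n : ℝ) ^ σ := by gcongr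
          _ = _ := by rw [← Real.rpow_add hn0]; congr 1; ring
      have h2 : (n : ℝ) ^ σ = 4 * (1 / (8 * R ^ 2) * (2 * R ^ 2 * (n : ℝ) ^ σ)) := by
        field_simp; norm_num
      have h3 : 1 / (8 * R ^ 2) * (2 * R ^ 2 * (n : ℝ) ^ σ) ≤
          (μ.prod μ).real {p : ℝ × ℝ | 1 ≤ |p.1 - p.2| ∧ |p.1 - p.2| ≤ 2 * R}
            * (n : ℝ) ^ (τ / 10) := by gcongr
      linarith
    · obtain ⟨h1, -⟩ := hp
      rw [norm_smul, Real.norm_eq_abs, abs_div, abs_of_pos Real.two_pi_pos]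
      calc (n : ℝ) ^ (4 * τ - 1 / 2) = ((n : ℝ) ^ τ)⁻¹ * (n : ℝ) ^ (5 * τ - 1 / 2) := by
            rw [← Real.rpow_neg hn0.le, ← Real.rpow_add hn0]; congr 1; ring
        _ ≤ 1 / (2 * Real.pi) * (n : ℝ) ^ (5 * τ - 1 / 2) := by rw [one_div (2 * Real.pi)]; gcongr
        _ ≤ |p.1 - p.2| / (2 * Real.pi) * ‖x‖ := by gcongr
    · obtain ⟨-, h2⟩ := hp
      rw [norm_smul, Real.norm_eq_abs, abs_div, abs_of_pos Real.two_pi_pos]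
      rw [Real.rpow_add hn0, mul_comm]
      gcongr
      rw [div_le_iff₀ Real.two_pi_pos]
      have : (n : ℝ) ^ (1 : ℝ) * 2 ≤ (n : ℝ) ^ (1 : ℝ) * (2 * Real.pi) := by gcongr; linarith
      linarith
  refine ⟨hy.charFun_map_randomWalk s t x, ?_, key⟩
  simpa [phiR4] using key ∅ (by simp)

theorem theorem2p6 (C : ℝ) (hC : 0 < C) (m : ℕ) :
    ∃ τ₀ : ℝ, 0 < τ₀ ∧ ∀ τ : ℝ, 0 < τ → τ < τ₀ →
    ∃ σ₀ : ℝ, 0 < σ₀ ∧ ∀ σ : ℝ, 0 < σ → σ < σ₀ →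
      (∀ μ : Measure ℝ, IsStandardizedLaw μ →
        ∃ N : ℕ, ∀ n : ℕ, N ≤ n → FourierDecay.{u} C τ σ m n μ) ∧
      (∀ ε M : ℝ, 0 < ε →
        ∃ N : ℕ, ∀ μ : Measure ℝ, IsStandardizedLaw μ →
          Integrable (fun a : ℝ => |a| ^ (2 + ε)) μ → ∫ a, |a| ^ (2 + ε) ∂μ ≤ M →
          ∀ n : ℕ, N ≤ n → FourierDecay.{u} C τ σ m n μ) := by
  refine ⟨1 / 16, by norm_num, fun τ hτ hτ1 ↦ ⟨τ / 10, by linarith, fun σ _ hσ ↦ ⟨?_, ?_⟩⟩⟩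
  · intro μ hμ
    obtain ⟨R, hR, htail⟩ := hμ.exists_tail_le
    obtain ⟨N, hN⟩ := exists_forall_fourierDecay hC hτ hτ1 hσ m hR
    exact ⟨N, hN μ hμ htail⟩
  · intro ε M hε
    obtain ⟨R, hR, htail⟩ := exists_forall_tail_le hε M
    obtain ⟨N, hN⟩ := exists_forall_fourierDecay hC hτ hτ1 hσ m hR
    exact ⟨N, fun μ hμ hint hM ↦ hN μ hμ (htail μ hμ hint hM)⟩
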